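/- Let $\alpha,\beta>0$, let $V(x)=\frac{\alpha}{|x|^{12}}-\frac{\beta}{|x|^{6}}$ for $x\in\mathbb{R}_+$, and let $C_0^\infty(\mathbb{R}_+)$ be the space of complex-valued smooth functions with compact support in $(0,\infty)$. On $$\mathcal{D}_q=\Big\{\varphi\in H^1(\mathbb{R}_+):\ \int_{\mathbb{R}_+}V(x)|\varphi(x)|^2\,dx<\infty\Big\}$$ consider the sesquilinear form $$q_{\alpha,\beta}[\varphi,h]=\int_{\mathbb{R}_+}\overline{\varphi'}\,h'\,dx+\int_{\mathbb{R}_+}V\,\overline{\varphi}\,h\,dx ,$$ and let $H_{\alpha,\beta}$ be the operator in the complex Hilbert space $L^2(\mathbb{R}_+)$ associated with it: its domain is the set of all $\varphi\in\mathcal{D}_q$ for which there is $\psi\in L^2(\mathbb{R}_+)$ with $q_{\alpha,\beta}[\varphi,h]=(\psi,h)$ for all $h\in\mathcal{D}_q$, and $H_{\alpha,\beta}\varphi=\psi$ (such a $\psi$ is unique). Let $H_{\min}$ be the operator $\varphi\mapsto-\varphi''+V\varphi$ with domain $C_0^\infty(\mathbb{R}_+)$. Then $H_{\alpha,\beta}$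 is self-adjoint, it extends $H_{\min}$, and it is the only self-adjoint operator in $L^2(\mathbb{R}_+)$ that extends $H_{\min}$. Moreover $H_{\min}$ is essentially self-adjoint, that is, $H_{\min}$ is closable and its closure is self-adjoint. -/

import Mathlib

open MeasureTheory Set TopologicalSpace
open scoped ComplexConjugate Distributions

noncomputable section

namespace LennardJones

/-- The open half-line `(0, ∞)`, as an open subset of `ℝ`. -/
abbrev halfLine : Opens ℝ := ⟨Ioi 0, isOpen_Ioi⟩

/-- The complex Hilbert space `L²(ℝ₊)`. Its inner product `inner ℂ f g = ∫ conj f * g` is linear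
in the second argument. -/
abbrev L2 : Type := Lp ℂ 2 (volume.restrict (Ioi (0 : ℝ)))

/-- The space `C₀^∞(ℝ₊)`: complex-valued smooth functions whose support is a compact subset of
`(0, ∞)`. -/
abbrev Test : Type := 𝓓(halfLine, ℂ)

/-- The Lennard-Jones potential. -/
def potential (α β : ℝ) (x : ℝ) : ℝ := α / |x| ^ 12 - β / |x| ^ 6

/-! ### Test functions as elements of `L²` -/

theorem memLp_of_continuous {g : ℝ → ℂ} (hg : Continuous g) (hs : HasCompactSupport g) :
    MemLp g 2 (volume.restrict (Ioi (0 : ℝ))) :=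
  (hg.memLp_of_hasCompactSupport hs).restrict _

theorem integrable_mul_of_continuous (u : L2) {g : ℝ → ℂ} (hg : Continuous g)
    (hs : HasCompactSupport g) :
    Integrable (fun x => u x * g x) (volume.restrict (Ioi (0 : ℝ))) :=
  (Lp.memLp u).integrable_mul (memLp_of_continuous hg hs)

theorem Test.continuous_deriv (η : Test) : Continuous (deriv η) :=
  η.contDiff.continuous_deriv (by simp)

theorem Test.continuous_deriv2 (η : Test) : Continuous (deriv (deriv η)) := by
  have h : ContDiff ℝ 2 η := contDiff_infty.1 η.contDiff 2
  have := h.continuous_iteratedDeriv 2 le_rfl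
  simpa [iteratedDeriv_succ, iteratedDeriv_zero] using this

theorem Test.continuous_potential_mul (α β : ℝ) (η : Test) :
    Continuous (fun x => (potential α β x : ℂ) * η x) := by
  refine continuous_of_tsupport fun x hx => ?_
  have hx' : x ∈ tsupport η := tsupport_mul_subset_right hx
  have hx0 : (0 : ℝ) < x := η.tsupport_subset hx'
  have hne : |x| ≠ 0 := by positivity
  have hV : ContinuousAt (potential α β) x := by
    unfold potential
    exact (continuousAt_const.div (continuous_abs.continuousAt.pow 12) (pow_ne_zero _ hne)).sub
      (continuousAt_const.div (continuous_abs.continuousAt.pow 6) (pow_ne_zero _ hne))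
  exact (Complex.continuous_ofReal.continuousAt.comp hV).mul η.continuous.continuousAt

/-- The differential expression `-f'' + V f` applied to a test function. -/
def expression (α β : ℝ) (f : Test) (x : ℝ) : ℂ :=
  -deriv (deriv f) x + (potential α β x : ℂ) * f x

theorem memLp_expression (α β : ℝ) (f : Test) :
    MemLp (expression α β f) 2 (volume.restrict (Ioi (0 : ℝ))) :=
  memLp_of_continuous (f.continuous_deriv2.neg.add (f.continuous_potential_mul α β))
    (f.hasCompactSupport.deriv.deriv.neg.add f.hasCompactSupport.mul_left)

theorem memLp_test (f : Test) : MemLp f 2 (volume.restrict (Ioi (0 : ℝ))) :=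
  memLp_of_continuous f.continuous f.hasCompactSupport

/-- The inclusion `C₀^∞(ℝ₊) → L²(ℝ₊)`. -/
def testToL2 : Test →ₗ[ℂ] L2 where
  toFun f := (memLp_test f).toLp f
  map_add' f g := MemLp.toLp_add (memLp_test f) (memLp_test g)
  map_smul' c f := MemLp.toLp_const_smul c (memLp_test f)

theorem coeFn_testToL2 (f : Test) : testToL2 f =ᵐ[volume.restrict (Ioi (0 : ℝ))] f :=
  (memLp_test f).coeFn_toLp

theorem testToL2_injective : Function.Injective testToL2 := by
  intro f g hfg
  have h : (f : ℝ → ℂ) =ᵐ[volume.restrict (Ioi (0 : ℝ))] g :=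
    (coeFn_testToL2 f).symm.trans (hfg ▸ coeFn_testToL2 g)
  have h' : EqOn f g (Ioi (0 : ℝ)) :=
    Measure.eqOn_open_of_ae_eq h isOpen_Ioi f.continuous.continuousOn g.continuous.continuousOn
  ext x
  by_cases hx : x ∈ Ioi (0 : ℝ)
  · exact h' hx
  · rw [image_eq_zero_of_notMem_tsupport fun hh => hx (f.tsupport_subset hh),
      image_eq_zero_of_notMem_tsupport fun hh => hx (g.tsupport_subset hh)]

/-- The map `f ↦ -f'' + V f` from `C₀^∞(ℝ₊)` to `L²(ℝ₊)`. -/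
def expressionToL2 (α β : ℝ) : Test →ₗ[ℂ] L2 where
  toFun f := (memLp_expression α β f).toLp _
  map_add' f g := by
    rw [← MemLp.toLp_add]
    congr 1
    funext x
    have h1 : deriv (f + g : Test) = deriv f + deriv g := by
      funext y
      have : ((f + g : Test) : ℝ → ℂ) = (f : ℝ → ℂ) + g := rfl
      rw [this]
      exact deriv_add (f.contDiff.differentiable (by simp) y)
        (g.contDiff.differentiable (by simp) y)
    have hd (f : Test) : Differentiable ℝ (deriv f) :=
      ContDiff.differentiable_deriv_two (contDiff_infty.1 f.contDiff 2)
    have h2 : deriv (deriv (f + g : Test)) x = deriv (deriv f) x + deriv (deriv g) x := by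
      rw [h1]
      exact deriv_add (hd f x) (hd g x)
    have h3 : (f + g : Test) x = f x + g x := rfl
    simp only [expression, Pi.add_apply, h2, h3]
    ring
  map_smul' c f := by
    rw [RingHom.id_apply, ← MemLp.toLp_const_smul]
    congr 1
    funext x
    have h0 : ((c • f : Test) : ℝ → ℂ) = fun y => c * f y := rfl
    have h1 : deriv (c • f : Test) = fun y => c * deriv f y := by
      rw [h0]; funext y; exact deriv_const_mul_field c
    have h2 : deriv (deriv (c • f : Test)) x = c * deriv (deriv f) x := by
      rw [h1]; exact deriv_const_mul_field c
    simp only [expression, h2, Pi.smul_apply, smul_eq_mul]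
    rw [h0]
    ring

/-- The minimal operator: `-d²/dx² + V` with domain `C₀^∞(ℝ₊) ⊆ L²(ℝ₊)`. -/
def minimalOperator (α β : ℝ) : L2 →ₗ.[ℂ] L2 where
  domain := LinearMap.range testToL2
  toFun := expressionToL2 α β ∘ₗ
    (LinearEquiv.ofInjective testToL2 testToL2_injective).symm.toLinearMap

theorem minimalOperator_apply (α β : ℝ) (f : Test) :
    minimalOperator α β ⟨testToL2 f, f, rfl⟩ = expressionToL2 α β f :=
  congrArg (expressionToL2 α β)
    ((LinearEquiv.ofInjective testToL2 testToL2_injective).symm_apply_apply f)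

/-! ### Weak derivatives and the Sobolev space `H¹` -/

/-- The pairs `(u, v)` of `L²(ℝ₊)`-functions such that `v` is the weak derivative of `u` on
`(0, ∞)`. -/
def weakDerivGraph : Submodule ℂ (L2 × L2) where
  carrier := {p | ∀ η : Test,
    ∫ x in Ioi (0 : ℝ), p.1 x * deriv η x = -∫ x in Ioi (0 : ℝ), p.2 x * η x}
  zero_mem' := by
    intro η
    have h : ((0 : L2) : ℝ → ℂ) =ᵐ[volume.restrict (Ioi (0 : ℝ))] 0 := Lp.coeFn_zero _ _ _
    have h1 (g : ℝ → ℂ) : ∫ x in Ioi (0 : ℝ), (0 : L2) x * g x = 0 := by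
      rw [integral_congr_ae (g := fun _ => (0 : ℂ)), integral_zero]
      filter_upwards [h] with x hx
      rw [hx, Pi.zero_apply, zero_mul]
    simp only [Prod.fst_zero, Prod.snd_zero]
    rw [h1, h1, neg_zero]
  add_mem' := by
    intro p q hp hq η
    have h (u v : L2) {g : ℝ → ℂ} (hg : Continuous g) (hs : HasCompactSupport g) :
        ∫ x in Ioi (0 : ℝ), (u + v) x * g x =
          (∫ x in Ioi (0 : ℝ), u x * g x) + ∫ x in Ioi (0 : ℝ), v x * g x := by
      rw [← integral_add (integrable_mul_of_continuous u hg hs)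
        (integrable_mul_of_continuous v hg hs)]
      refine integral_congr_ae ?_
      filter_upwards [Lp.coeFn_add u v] with x hx
      rw [hx, Pi.add_apply, add_mul]
    simp only [Prod.fst_add, Prod.snd_add]
    rw [h _ _ η.continuous_deriv η.hasCompactSupport.deriv,
      h _ _ η.continuous η.hasCompactSupport, hp η, hq η]
    ring
  smul_mem' := by
    intro c p hp η
    have h (u : L2) (g : ℝ → ℂ) :
        ∫ x in Ioi (0 : ℝ), (c • u) x * g x = c * ∫ x in Ioi (0 : ℝ), u x * g x := by
      rw [← integral_const_mul]
      refine integral_congr_ae ?_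
      filter_upwards [Lp.coeFn_smul c u] with x hx
      rw [hx, Pi.smul_apply, smul_eq_mul, mul_assoc]
    simp only [Prod.smul_fst, Prod.smul_snd]
    rw [h, h, hp η]
    ring

theorem eq_zero_of_forall_test (u : L2)
    (h : ∀ η : Test, ∫ x in Ioi (0 : ℝ), u x * η x = 0) : u = 0 := by
  rw [Lp.eq_zero_iff_ae_eq_zero]
  have hloc : LocallyIntegrableOn u (Ioi (0 : ℝ)) := by
    rw [locallyIntegrableOn_iff isOpen_Ioi.isLocallyClosed]
    intro k hk hkc
    have h1 : MemLp u 2 (volume.restrict k) := (Lp.memLp u).mono_measure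
      (Measure.restrict_mono hk le_rfl)
    have : IsFiniteMeasure (volume.restrict k) := ⟨by simpa using hkc.measure_lt_top⟩
    exact h1.integrable (by norm_num)
  have := isOpen_Ioi.ae_eq_zero_of_integral_contDiff_smul_eq_zero hloc (fun g hg hgs hgt => by
    have hs : Function.support (fun x => (g x : ℂ)) = Function.support g := by
      ext x; simp
    let η : Test := ⟨fun x => (g x : ℂ), Complex.ofRealCLM.contDiff.comp hg,
      by rw [HasCompactSupport, tsupport, hs]; exact hgs,
      by rw [tsupport, hs]; exact hgt⟩
    have h1 := h η
    rw [← integral_indicator measurableSet_Ioi] at h1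
    rw [← h1]
    congr 1
    funext x
    by_cases hx : x ∈ Ioi (0 : ℝ)
    · rw [indicator_of_mem hx, Complex.real_smul, mul_comm]
      rfl
    · rw [indicator_of_notMem hx, image_eq_zero_of_notMem_tsupport fun hh => hx (hgt hh),
        zero_smul])
  exact (ae_restrict_iff' measurableSet_Ioi).2 this

/-- Weak derivatives are unique. -/
theorem weakDerivGraph_unique (p : L2 × L2) (hp : p ∈ weakDerivGraph) (h0 : p.1 = 0) :
    p.2 = 0 := by
  refine eq_zero_of_forall_test _ fun η => ?_
  obtain ⟨u, v⟩ := p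
  have h0 : u = 0 := h0
  subst h0
  have h := hp η
  have h1 : ∫ x in Ioi (0 : ℝ), (0 : L2) x * deriv η x = 0 := by
    rw [integral_congr_ae (g := fun _ => (0 : ℂ)), integral_zero]
    filter_upwards [Lp.coeFn_zero ℂ 2 (volume.restrict (Ioi (0 : ℝ)))] with x hx
    rw [hx, Pi.zero_apply, zero_mul]
  simp only at h
  rw [h1] at h
  exact neg_eq_zero.1 h.symm

/-- The weak derivative `u ↦ u'`, defined for those `u ∈ L²(ℝ₊)` that have a weak derivative in
`L²(ℝ₊)`. -/
def weakDeriv : L2 →ₗ.[ℂ] L2 := weakDerivGraph.toLinearPMap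

theorem weakDeriv_graph : weakDeriv.graph = weakDerivGraph :=
  weakDerivGraph.toLinearPMap_graph_eq weakDerivGraph_unique

/-- The Sobolev space `H¹(ℝ₊)`. -/
def sobolevH1 : Submodule ℂ L2 := weakDeriv.domain

/-! ### The quadratic form and the operator associated with it -/

theorem aestronglyMeasurable_potential (α β : ℝ) :
    AEStronglyMeasurable (potential α β) (volume.restrict (Ioi (0 : ℝ))) := by
  have : Measurable (potential α β) := by unfold potential; fun_prop
  exact this.aestronglyMeasurable

theorem integrable_potential_mul {α β : ℝ} {u v : L2}
    (hu : Integrable (fun x => potential α β x * ‖u x‖ ^ 2) (volume.restrict (Ioi (0 : ℝ))))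
    (hv : Integrable (fun x => potential α β x * ‖v x‖ ^ 2) (volume.restrict (Ioi (0 : ℝ)))) :
    Integrable (fun x => (potential α β x : ℂ) * (conj (u x) * v x))
      (volume.restrict (Ioi (0 : ℝ))) := by
  refine (hu.norm.add hv.norm).mono' ?_ (.of_forall fun x => ?_)
  · exact (Complex.continuous_ofReal.comp_aestronglyMeasurable
      (aestronglyMeasurable_potential α β)).mul
      ((Complex.continuous_conj.comp_aestronglyMeasurable (Lp.aestronglyMeasurable u)).mul
        (Lp.aestronglyMeasurable v))
  · simp only [Pi.add_apply, norm_mul, Complex.norm_real, RCLike.norm_conj, norm_pow, norm_norm]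
    rw [← mul_add]
    exact mul_le_mul_of_nonneg_left
      (by nlinarith [sq_nonneg (‖u x‖ - ‖v x‖), norm_nonneg (u x), norm_nonneg (v x),
        mul_nonneg (norm_nonneg (u x)) (norm_nonneg (v x))]) (norm_nonneg _)

/-- The form domain: all `φ ∈ H¹(ℝ₊)` with `∫ V |φ|² < ∞`. For `α, β > 0` the potential is bounded
from below and `φ` is square integrable, so finiteness of this integral is integrability. -/
def formDomain (α β : ℝ) : Submodule ℂ L2 where
  carrier := {φ | φ ∈ sobolevH1 ∧
    Integrable (fun x => potential α β x * ‖φ x‖ ^ 2) (volume.restrict (Ioi (0 : ℝ)))}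
  zero_mem' := by
    refine ⟨zero_mem _, (integrable_zero ℝ ℝ _).congr ?_⟩
    filter_upwards [Lp.coeFn_zero ℂ 2 (volume.restrict (Ioi (0 : ℝ)))] with x hx
    rw [hx, Pi.zero_apply, Pi.zero_apply, norm_zero, zero_pow two_ne_zero, mul_zero]
  add_mem' := by
    rintro u v ⟨hu1, hu⟩ ⟨hv1, hv⟩
    refine ⟨add_mem hu1 hv1, ((hu.norm.const_mul 2).add (hv.norm.const_mul 2)).mono' ?_ ?_⟩
    · exact (aestronglyMeasurable_potential α β).mul
        ((Lp.aestronglyMeasurable (u + v)).norm.pow 2)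
    · filter_upwards [Lp.coeFn_add u v] with x hx
      rw [hx]
      simp only [Pi.add_apply, norm_mul, norm_pow, norm_norm]
      have h1 : ‖u x + v x‖ ^ 2 ≤ 2 * ‖u x‖ ^ 2 + 2 * ‖v x‖ ^ 2 := by
        have := norm_add_le (u x) (v x)
        nlinarith [sq_nonneg (‖u x‖ - ‖v x‖), norm_nonneg (u x + v x)]
      nlinarith [mul_le_mul_of_nonneg_left h1 (norm_nonneg (potential α β x))]
  smul_mem' := by
    rintro c u ⟨hu1, hu⟩
    refine ⟨Submodule.smul_mem _ c hu1, (hu.const_mul (‖c‖ ^ 2)).congr ?_⟩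
    filter_upwards [Lp.coeFn_smul c u] with x hx
    rw [hx, Pi.smul_apply, norm_smul]
    ring

/-- The weak derivative of an element of the form domain. -/
def formDeriv (α β : ℝ) : formDomain α β →ₗ[ℂ] L2 :=
  weakDeriv.toFun ∘ₗ Submodule.inclusion (fun _ h => h.1 : formDomain α β ≤ weakDeriv.domain)

/-- The sesquilinear form `q[φ, h] = ∫ conj φ' h' + ∫ V conj φ h` on the form domain, linear in `h`,
whose quadratic form is `∫ |φ'|² + α ∫ |φ|² / |x|¹² - β ∫ |φ|² / |x|⁶`. -/
def form (α β : ℝ) (φ h : formDomain α β) : ℂ :=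
  (∫ x in Ioi (0 : ℝ), conj (formDeriv α β φ x) * formDeriv α β h x) +
    ∫ x in Ioi (0 : ℝ), (potential α β x : ℂ) * (conj ((φ : L2) x) * (h : L2) x)

theorem form_eq (α β : ℝ) (φ h : formDomain α β) :
    form α β φ h = inner ℂ (formDeriv α β φ) (formDeriv α β h) +
      ∫ x in Ioi (0 : ℝ), (potential α β x : ℂ) * (conj ((φ : L2) x) * (h : L2) x) := by
  simp only [form, L2.inner_def, RCLike.inner_apply']

theorem form_add (α β : ℝ) (φ ψ h : formDomain α β) :
    form α β (φ + ψ) h = form α β φ h + form α β ψ h := by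
  have h1 : ∫ x in Ioi (0 : ℝ), (potential α β x : ℂ) *
        (conj (((φ + ψ : formDomain α β) : L2) x) * (h : L2) x) =
      (∫ x in Ioi (0 : ℝ), (potential α β x : ℂ) * (conj ((φ : L2) x) * (h : L2) x)) +
        ∫ x in Ioi (0 : ℝ), (potential α β x : ℂ) * (conj ((ψ : L2) x) * (h : L2) x) := by
    rw [← integral_add (integrable_potential_mul φ.2.2 h.2.2)
      (integrable_potential_mul ψ.2.2 h.2.2)]
    refine integral_congr_ae ?_
    filter_upwards [Lp.coeFn_add (φ : L2) (ψ : L2)] with x hx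
    rw [Submodule.coe_add, hx, Pi.add_apply, map_add]
    ring
  rw [form_eq, form_eq, form_eq, h1, map_add, inner_add_left]
  ring

theorem form_smul (α β : ℝ) (c : ℂ) (φ h : formDomain α β) :
    form α β (c • φ) h = conj c * form α β φ h := by
  have h1 : ∫ x in Ioi (0 : ℝ), (potential α β x : ℂ) *
        (conj (((c • φ : formDomain α β) : L2) x) * (h : L2) x) =
      conj c * ∫ x in Ioi (0 : ℝ), (potential α β x : ℂ) * (conj ((φ : L2) x) * (h : L2) x) := by
    rw [← integral_const_mul]
    refine integral_congr_ae ?_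
    filter_upwards [Lp.coeFn_smul c (φ : L2)] with x hx
    rw [Submodule.coe_smul, hx, Pi.smul_apply, smul_eq_mul, map_mul]
    ring
  rw [form_eq, form_eq, h1, map_smul, inner_smul_left]
  ring

/-- The pairs `(φ, ψ)` with `φ` in the form domain, `ψ ∈ L²(ℝ₊)` and `q[φ, h] = (ψ, h)` for all `h`
in the form domain. -/
def formOperatorGraph (α β : ℝ) : Submodule ℂ (L2 × L2) where
  carrier := {p | ∃ hp : p.1 ∈ formDomain α β, ∀ h : formDomain α β,
    form α β ⟨p.1, hp⟩ h = inner ℂ p.2 (h : L2)}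
  zero_mem' := by
    refine ⟨zero_mem _, fun h => ?_⟩
    have := form_smul α β 0 0 h
    rw [zero_smul, map_zero, zero_mul] at this
    rw [Prod.snd_zero, inner_zero_left]
    exact this
  add_mem' := by
    rintro p q ⟨hp1, hp⟩ ⟨hq1, hq⟩
    refine ⟨add_mem hp1 hq1, fun h => ?_⟩
    rw [Prod.snd_add, inner_add_left, ← hp h, ← hq h]
    exact form_add α β ⟨p.1, hp1⟩ ⟨q.1, hq1⟩ h
  smul_mem' := by
    rintro c p ⟨hp1, hp⟩
    refine ⟨Submodule.smul_mem _ c hp1, fun h => ?_⟩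
    rw [Prod.smul_snd, inner_smul_left, ← hp h]
    exact form_smul α β c ⟨p.1, hp1⟩ h

theorem testToL2_mem_sobolevH1 (f : Test) : testToL2 f ∈ sobolevH1 := by
  refine Submodule.mem_map.2 ⟨(testToL2 f, (memLp_of_continuous f.continuous_deriv
    f.hasCompactSupport.deriv).toLp _), fun η => ?_, rfl⟩
  have e1 : ∫ x in Ioi (0 : ℝ), testToL2 f x * deriv η x = ∫ x, f x * deriv η x := by
    rw [setIntegral_congr_ae (g := fun x => f x * deriv η x) measurableSet_Ioi]
    · refine setIntegral_eq_integral_of_forall_compl_eq_zero fun x hx => ?_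
      rw [image_eq_zero_of_notMem_tsupport fun hh => hx (f.tsupport_subset hh), zero_mul]
    · rw [← ae_restrict_iff' measurableSet_Ioi]
      filter_upwards [coeFn_testToL2 f] with x hx
      rw [hx]
  have e2 : ∫ x in Ioi (0 : ℝ), ((memLp_of_continuous f.continuous_deriv
      f.hasCompactSupport.deriv).toLp _ : L2) x * η x = ∫ x, deriv f x * η x := by
    rw [setIntegral_congr_ae (g := fun x => deriv f x * η x) measurableSet_Ioi]
    · refine setIntegral_eq_integral_of_forall_compl_eq_zero fun x hx => ?_
      rw [image_eq_zero_of_notMem_tsupport fun hh => hx (η.tsupport_subset hh), mul_zero]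
    · rw [← ae_restrict_iff' measurableSet_Ioi]
      filter_upwards [(memLp_of_continuous f.continuous_deriv
        f.hasCompactSupport.deriv).coeFn_toLp] with x hx
      rw [hx]
  simp only
  rw [e1, e2]
  refine integral_mul_deriv_eq_deriv_mul_of_integrable
    (fun x _ => (f.contDiff.differentiable (by simp) x).hasDerivAt)
    (fun x _ => (η.contDiff.differentiable (by simp) x).hasDerivAt) ?_ ?_ ?_
  · exact (f.continuous.mul η.continuous_deriv).integrable_of_hasCompactSupport
      f.hasCompactSupport.mul_right
  · exact (f.continuous_deriv.mul η.continuous).integrable_of_hasCompactSupport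
      η.hasCompactSupport.mul_left
  · exact (f.continuous.mul η.continuous).integrable_of_hasCompactSupport
      f.hasCompactSupport.mul_right

theorem testToL2_mem_formDomain (α β : ℝ) (f : Test) : testToL2 f ∈ formDomain α β := by
  refine ⟨testToL2_mem_sobolevH1 f, ?_⟩
  have h1 : Integrable (fun x => ((potential α β x : ℂ) * f x) * conj (f x))
      (volume.restrict (Ioi (0 : ℝ))) :=
    (((f.continuous_potential_mul α β).mul
      (Complex.continuous_conj.comp f.continuous)).integrable_of_hasCompactSupport
        f.hasCompactSupport.mul_left.mul_right).restrict
  refine h1.re.congr ?_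
  filter_upwards [coeFn_testToL2 f] with x hx
  rw [hx, mul_assoc, Complex.mul_conj, ← Complex.ofReal_mul, Complex.normSq_eq_norm_sq]
  exact Complex.ofReal_re _

/-- The form domain is dense, so `ψ` is determined by `φ`. -/
theorem formOperatorGraph_unique (α β : ℝ) (p : L2 × L2) (hp : p ∈ formOperatorGraph α β)
    (h0 : p.1 = 0) : p.2 = 0 := by
  obtain ⟨u, v⟩ := p
  have h0 : u = 0 := h0
  subst h0
  obtain ⟨hp1, hp⟩ := hp
  have hz (h : formDomain α β) : inner ℂ v (h : L2) = 0 := by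
    rw [← hp h]
    have := form_smul α β 0 0 h
    rw [zero_smul, map_zero, zero_mul] at this
    exact this
  refine eq_zero_of_forall_test v fun η => ?_
  let η' : Test := ⟨fun x => conj (η x), Complex.conjCLE.contDiff.comp η.contDiff,
    η.hasCompactSupport.comp_left (g := fun z : ℂ => conj z) (map_zero _),
    (closure_mono (Function.support_comp_subset (g := fun z : ℂ => conj z) (map_zero _) η)).trans
      η.tsupport_subset⟩
  have h1 := hz ⟨testToL2 η', testToL2_mem_formDomain α β η'⟩
  rw [← inner_conj_symm, map_eq_zero, L2.inner_def] at h1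
  rw [← h1]
  refine integral_congr_ae ?_
  filter_upwards [coeFn_testToL2 η'] with x hx
  rw [RCLike.inner_apply', hx]
  change v x * η x = conj (conj (η x)) * v x
  rw [Complex.conj_conj, mul_comm]

/-- The operator `H` associated with the form: its domain consists of all `φ` in the form domain for
which there is `ψ ∈ L²(ℝ₊)` with `q[φ, h] = (ψ, h)` for all `h` in the form domain, and then
`H φ = ψ`. -/
def formOperator (α β : ℝ) : L2 →ₗ.[ℂ] L2 := (formOperatorGraph α β).toLinearPMap

theorem formOperator_graph (α β : ℝ) : (formOperator α β).graph = formOperatorGraph α β :=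
  (formOperatorGraph α β).toLinearPMap_graph_eq (formOperatorGraph_unique α β)

/-- An operator is essentially self-adjoint if it is closable with self-adjoint closure. -/
def IsEssentiallySelfAdjoint (T : L2 →ₗ.[ℂ] L2) : Prop :=
  T.IsClosable ∧ IsSelfAdjoint T.closure

end LennardJones

end

noncomputable section

namespace LennardJones

open Filter Topology
open scoped ContDiff

/-! ### Locally absolutely continuous functions on the half-line -/

/-! Write T for `minimalOperator`, which is symmetric and densely defined, and S for `formOperator`,
which is symmetric. Everything follows from T* ≤ S (`adjoint_minimalOperator_le`). Indeed T ≤ T* ≤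
S, and S ≤ S* ≤ T* ≤ S makes S self-adjoint and equal to T*. A self-adjoint B above T satisfies B =
B* ≤ T* ≤ S, hence also S = S* ≤ B* = B. Finally S = S* = T**, which is the closure of T.

The inclusion T* ≤ S says that a square integrable weak solution u of -u'' + V u = w, with w in L²,
has finite energy and solves the equation against the whole form domain. By du Bois-Reymond
(`exists_isPrimitive_of_weakDeriv2`), u is C¹ and p = u' is locally absolutely continuous. For a
compactly supported real cutoff φ, multiplication by φ² conj u and integration give ∫ |(φu)'|² + V
φ²|u|² = ∫ φ'²|u|² + Re ∫ φ² conj(u) w, so that only φ'u has to be controlled. Cutting off near 0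
costs |φ'| of order 1/x, and u/x is not known to be square integrable at the outset. The strong
repulsion at 0 supplies this: with the damping factor ψ = x/(1+x) the quotient ψ/x is bounded, and
the resulting bound on V ψ²|u|² controls |u|²/x¹⁰ near 0, more than enough. A second pass with ψ = 1
gives finite energy (`integrable_norm_sq_and_potential`).

The same repulsion puts h/x in L² for every h in the form domain. The cutoff error in Green's
formula is then dominated by a multiple of |p||h|/x and disappears in the limit (`integral_green`).
-/

theorem uIcc_subset_Ioi {a b c : ℝ} (ha : c < a) (hb : c < b) : uIcc a b ⊆ Ioi c :=
  fun _ hx => lt_of_lt_of_le (lt_min ha hb) hx.1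

theorem intervalIntegrable_of_locallyIntegrableOn {f : ℝ → ℂ}
    (hf : LocallyIntegrableOn f (Ioi (0 : ℝ))) {a b : ℝ} (ha : 0 < a) (hb : 0 < b) :
    IntervalIntegrable f volume a b :=
  (intervalIntegrable_iff.2 ((hf.integrableOn_compact_subset (uIcc_subset_Ioi ha hb)
    isCompact_uIcc).mono_set uIoc_subset_uIcc))

/-- `F` is locally absolutely continuous on `(0, ∞)` with almost everywhere derivative `f`. -/
structure IsPrimitive (F f : ℝ → ℂ) : Prop where
  locallyIntegrableOn : LocallyIntegrableOn f (Ioi (0 : ℝ))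
  sub_eq : ∀ a b : ℝ, 0 < a → 0 < b → F b - F a = ∫ x in a..b, f x

/-- The base point 1 lies inside the half-line because `f` need not be integrable up to 0. -/
theorem isPrimitive_integral {f : ℝ → ℂ} (hf : LocallyIntegrableOn f (Ioi (0 : ℝ))) (c : ℂ) :
    IsPrimitive (fun x => (∫ t in (1 : ℝ)..x, f t) + c) f where
  locallyIntegrableOn := hf
  sub_eq a b ha hb := by
    rw [add_sub_add_right_eq_sub]
    exact intervalIntegral.integral_interval_sub_left
      (intervalIntegrable_of_locallyIntegrableOn hf one_pos hb)
      (intervalIntegrable_of_locallyIntegrableOn hf one_pos ha)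

/-- Increments of `F` are bounded by those of the indefinite integral of `‖f‖`, whose absolute
continuity is known. -/
theorem absolutelyContinuousOnInterval_of_sub_eq {F f : ℝ → ℂ} {a b : ℝ}
    (hf : IntervalIntegrable f volume a b)
    (hF : ∀ x ∈ uIcc a b, ∀ y ∈ uIcc a b, F y - F x = ∫ t in x..y, f t) :
    AbsolutelyContinuousOnInterval F a b := by
  have hsub {x y : ℝ} (hx : x ∈ uIcc a b) (hy : y ∈ uIcc a b) :
      IntervalIntegrable f volume x y := hf.mono_set (uIcc_subset_uIcc hx hy)
  have hN := hf.norm.absolutelyContinuousOnInterval_intervalIntegral left_mem_uIcc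
  have hd {x y : ℝ} (hx : x ∈ uIcc a b) (hy : y ∈ uIcc a b) :
      dist (F x) (F y) ≤ dist (∫ v in a..x, ‖f v‖) (∫ v in a..y, ‖f v‖) := by
    rw [dist_comm, dist_comm (∫ v in a..x, ‖f v‖), dist_eq_norm, hF x hx y hy, Real.dist_eq,
      intervalIntegral.integral_interval_sub_left (hsub left_mem_uIcc hy).norm
        (hsub left_mem_uIcc hx).norm]
    exact intervalIntegral.norm_integral_le_abs_integral_norm
  refine squeeze_zero' (.of_forall fun _ => Finset.sum_nonneg fun _ _ => dist_nonneg) ?_ hN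
  rw [eventually_inf_principal]
  refine .of_forall fun E hE => Finset.sum_le_sum fun i hi => ?_
  exact hd (hE.1 i hi).1 (hE.1 i hi).2

namespace IsPrimitive

variable {F f G g : ℝ → ℂ}

theorem intervalIntegrable (h : IsPrimitive F f) {a b : ℝ} (ha : 0 < a) (hb : 0 < b) :
    IntervalIntegrable f volume a b :=
  intervalIntegrable_of_locallyIntegrableOn h.locallyIntegrableOn ha hb

theorem absolutelyContinuousOnInterval (h : IsPrimitive F f) {a b : ℝ} (ha : 0 < a)
    (hb : 0 < b) : AbsolutelyContinuousOnInterval F a b :=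
  absolutelyContinuousOnInterval_of_sub_eq (h.intervalIntegrable ha hb) fun _ hx _ hy =>
    h.sub_eq _ _ (uIcc_subset_Ioi ha hb hx) (uIcc_subset_Ioi ha hb hy)

theorem continuousOn (h : IsPrimitive F f) : ContinuousOn F (Ioi (0 : ℝ)) := by
  intro x hx
  have hx : (0 : ℝ) < x := hx
  have := (h.absolutelyContinuousOnInterval (half_pos hx) (by positivity : 0 < 2 * x)).continuousOn
  rw [uIcc_of_le (by linarith)] at this
  exact (this.continuousAt (Icc_mem_nhds (by linarith) (by linarith))).continuousWithinAt

theorem ae_hasDerivAt (h : IsPrimitive F f) {a b : ℝ} (ha : 0 < a) (hb : 0 < b) :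
    ∀ᵐ x, x ∈ uIcc a b → HasDerivAt F (f x) x := by
  filter_upwards [(h.intervalIntegrable ha hb).ae_hasDerivAt_integral] with x hx hxab
  have h1 := (hx hxab a left_mem_uIcc).const_add (F a)
  refine h1.congr_of_eventuallyEq ?_
  filter_upwards [isOpen_Ioi.mem_nhds (uIcc_subset_Ioi ha hb hxab)] with y hy
  rw [← h.sub_eq a y ha hy, add_sub_cancel]

theorem of_hasDerivAt (hF : ∀ x, 0 < x → HasDerivAt F (f x) x)
    (hf : ContinuousOn f (Ioi (0 : ℝ))) : IsPrimitive F f where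
  locallyIntegrableOn := hf.locallyIntegrableOn measurableSet_Ioi
  sub_eq _ _ ha hb := (intervalIntegral.integral_eq_sub_of_hasDerivAt
    (fun x hx => hF x (uIcc_subset_Ioi ha hb hx))
    (hf.mono (uIcc_subset_Ioi ha hb)).intervalIntegrable).symm

/-- This is integration by parts. The difference between `F G` and an indefinite integral of `f G +
F g` is absolutely continuous with derivative zero almost everywhere, hence constant on each compact
interval. -/
theorem mul (h : IsPrimitive F f) (k : IsPrimitive G g) :
    IsPrimitive (fun x => F x * G x) (fun x => f x * G x + F x * g x) := by
  have hl : LocallyIntegrableOn (fun x => f x * G x + F x * g x) (Ioi (0 : ℝ)) :=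
    (h.locallyIntegrableOn.mul_continuousOn k.continuousOn isOpen_Ioi.isLocallyClosed).add
      (k.locallyIntegrableOn.continuousOn_mul h.continuousOn isOpen_Ioi.isLocallyClosed)
  refine ⟨hl, fun a b ha hb => ?_⟩
  have hp := isPrimitive_integral hl 0
  have hac := ((h.absolutelyContinuousOnInterval ha hb).smul
    (k.absolutelyContinuousOnInterval ha hb)).sub (hp.absolutelyContinuousOnInterval ha hb)
  obtain ⟨C, hC⟩ := hac.const_of_ae_hasDerivAt_zero (by
    filter_upwards [h.ae_hasDerivAt ha hb, k.ae_hasDerivAt ha hb, hp.ae_hasDerivAt ha hb]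
      with x h1 h2 h3 hx
    simpa using ((h1 hx).mul (h2 hx)).sub (h3 hx))
  have e := (hC a left_mem_uIcc).trans (hC b right_mem_uIcc).symm
  rw [← hp.sub_eq a b ha hb]
  simp only [Pi.sub_apply, smul_eq_mul, Pi.mul_apply] at e
  linear_combination -e

protected theorem conjugate (h : IsPrimitive F f) :
    IsPrimitive (fun x => conj (F x)) (fun x => conj (f x)) where
  locallyIntegrableOn := fun x hx => by
    obtain ⟨s, hs, hi⟩ := h.locallyIntegrableOn x hx
    exact ⟨s, hs, Complex.conjLIE.integrable_comp_iff.2 hi⟩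
  sub_eq a b ha hb := by
    rw [← map_sub, h.sub_eq a b ha hb, intervalIntegral, intervalIntegral, map_sub,
      ← integral_conj, ← integral_conj]

theorem add_const (h : IsPrimitive F f) (c : ℂ) : IsPrimitive (fun x => F x + c) f where
  locallyIntegrableOn := h.locallyIntegrableOn
  sub_eq a b ha hb := by rw [add_sub_add_right_eq_sub, h.sub_eq a b ha hb]

theorem congr (h : IsPrimitive F f) (hfg : f =ᵐ[volume.restrict (Ioi (0 : ℝ))] g) :
    IsPrimitive F g where
  locallyIntegrableOn := by
    rw [locallyIntegrableOn_iff isOpen_Ioi.isLocallyClosed]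
    intro k hk hkc
    exact (h.locallyIntegrableOn.integrableOn_compact_subset hk hkc).congr
      (ae_restrict_of_ae_restrict_of_subset hk hfg)
  sub_eq a b ha hb := by
    rw [h.sub_eq a b ha hb]
    refine intervalIntegral.integral_congr_ae ?_
    filter_upwards [(ae_restrict_iff' measurableSet_Ioi).1 hfg] with x hx hxab
    exact hx (uIcc_subset_Ioi ha hb (uIoc_subset_uIcc hxab))

/-- The derivative of a compactly supported function has vanishing integral. -/
theorem integral_eq_zero (h : IsPrimitive F f) {a b : ℝ} (ha : 0 < a) (hab : a ≤ b)
    (hFa : F a = 0) (hFb : F b = 0) (hf : ∀ x ∉ Ioc a b, f x = 0) :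
    ∫ x in Ioi (0 : ℝ), f x = 0 := by
  have h1 := h.sub_eq a b ha (ha.trans_le hab)
  rw [hFa, hFb, sub_zero, intervalIntegral.integral_of_le hab] at h1
  rw [h1]
  exact (setIntegral_eq_of_subset_of_forall_sdiff_eq_zero measurableSet_Ioi
    (fun x hx => ha.trans hx.1) fun x hx => hf x hx.2)

end IsPrimitive

theorem integrableOn_mul_of_continuousOn {v φ : ℝ → ℂ}
    (hv : LocallyIntegrableOn v (Ioi (0 : ℝ))) (hφ : ContinuousOn φ (Ioi (0 : ℝ)))
    {a b : ℝ} (ha : 0 < a) (hs : ∀ x ∉ Icc a b, φ x = 0) :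
    IntegrableOn (fun x => v x * φ x) (Ioi (0 : ℝ)) := by
  have hsub : Icc a b ⊆ Ioi (0 : ℝ) := fun x hx => ha.trans_le hx.1
  have h1 : IntegrableOn (fun x => v x * φ x) (Icc a b) :=
    (hv.integrableOn_compact_subset hsub isCompact_Icc).mul_continuousOn (hφ.mono hsub)
      isCompact_Icc
  refine (h1.of_forall_sdiff_eq_zero measurableSet_Ioi fun x hx => ?_)
  rw [hs x hx.2, mul_zero]

/-! ### Test functions -/

theorem Test.exists_support (η : Test) :
    ∃ a b : ℝ, 0 < a ∧ a ≤ b ∧ ∀ x ∉ Ioo a b, x ∉ tsupport η := by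
  have hc : IsCompact (tsupport η) := η.hasCompactSupport
  rcases (tsupport η).eq_empty_or_nonempty with h | h
  · exact ⟨1, 1, one_pos, le_rfl, by simp [h]⟩
  · obtain ⟨p, hp, hp'⟩ := hc.exists_isLeast h
    obtain ⟨q, hq, hq'⟩ := hc.exists_isGreatest h
    have hp0 : (0 : ℝ) < p := η.tsupport_subset hp
    -- The interval is enlarged strictly beyond the support, so that test functions vanish at its
    -- endpoints too and no boundary terms survive.
    refine ⟨p / 2, q + 1, half_pos hp0, by linarith [hp' hq], fun x hx hxs => hx ⟨?_, ?_⟩⟩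
    · linarith [hp' hxs]
    · linarith [hq' hxs]

theorem Test.deriv_eq_zero (η : Test) {x : ℝ} (hx : x ∉ tsupport η) : deriv η x = 0 :=
  image_eq_zero_of_notMem_tsupport fun h => hx (tsupport_deriv_subset (𝕜 := ℝ) h)

theorem Test.hasDerivAt (η : Test) (x : ℝ) : HasDerivAt η (deriv η x) x :=
  (η.contDiff.differentiable (by simp) x).hasDerivAt

theorem Test.isPrimitive (η : Test) : IsPrimitive η (deriv η) :=
  .of_hasDerivAt (fun x _ => η.hasDerivAt x) η.continuous_deriv.continuousOn

/-- The derivative of a test function. -/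
def Test.derivative (η : Test) : Test where
  toFun := deriv η
  contDiff' := ((contDiff_infty_iff_deriv (𝕜 := ℝ)).1 η.contDiff).2
  hasCompactSupport' := η.hasCompactSupport.deriv
  tsupport_subset' := (tsupport_deriv_subset (𝕜 := ℝ)).trans η.tsupport_subset

theorem Test.coe_derivative (η : Test) : (η.derivative : ℝ → ℂ) = deriv η := rfl

theorem Test.integrableOn_mul (η : Test) {v : ℝ → ℂ}
    (hv : LocallyIntegrableOn v (Ioi (0 : ℝ))) :
    IntegrableOn (fun x => v x * η x) (Ioi (0 : ℝ)) := by
  obtain ⟨a, b, ha, -, h⟩ := η.exists_support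
  exact integrableOn_mul_of_continuousOn hv η.continuous.continuousOn ha fun x hx =>
    image_eq_zero_of_notMem_tsupport (h x fun hh => hx (Ioo_subset_Icc_self hh))

theorem Test.integrableOn_mul_deriv (η : Test) {v : ℝ → ℂ}
    (hv : LocallyIntegrableOn v (Ioi (0 : ℝ))) :
    IntegrableOn (fun x => v x * deriv η x) (Ioi (0 : ℝ)) :=
  η.derivative.integrableOn_mul hv

theorem IsPrimitive.integral_mul_deriv {F f : ℝ → ℂ} (h : IsPrimitive F f) (η : Test) :
    ∫ x in Ioi (0 : ℝ), F x * deriv η x = -∫ x in Ioi (0 : ℝ), f x * η x := by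
  obtain ⟨a, b, ha, hab, hs⟩ := η.exists_support
  have hη (x : ℝ) (hx : x ∉ Ioo a b) : η x = 0 := image_eq_zero_of_notMem_tsupport (hs x hx)
  have h1 := (h.mul η.isPrimitive).integral_eq_zero ha hab (by simp [hη a]) (by simp [hη b])
    fun x hx => by
      have hx : x ∉ Ioo a b := fun hh => hx ⟨hh.1, hh.2.le⟩
      simp [hη x hx, η.deriv_eq_zero (hs x hx)]
  rw [integral_add (η.integrableOn_mul h.locallyIntegrableOn)
    (η.integrableOn_mul_deriv (h.continuousOn.locallyIntegrableOn measurableSet_Ioi))] at h1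
  exact eq_neg_of_add_eq_zero_right h1

/-! ### The lemma of du Bois-Reymond -/

/-- Local integrability suffices here, unlike in `eq_zero_of_forall_test`; the functions tested
below contain primitives and constants, which need not be in L². -/
theorem ae_eq_zero_of_forall_integral_mul_test {v : ℝ → ℂ}
    (hv : LocallyIntegrableOn v (Ioi (0 : ℝ)))
    (h : ∀ η : Test, ∫ x in Ioi (0 : ℝ), v x * η x = 0) :
    v =ᵐ[volume.restrict (Ioi (0 : ℝ))] 0 := by
  have := isOpen_Ioi.ae_eq_zero_of_integral_contDiff_smul_eq_zero hv (fun g hg hgs hgt => by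
    have hs : Function.support (fun x => (g x : ℂ)) = Function.support g := by
      ext x; simp
    let η : Test := ⟨fun x => (g x : ℂ), Complex.ofRealCLM.contDiff.comp hg,
      by rw [HasCompactSupport, tsupport, hs]; exact hgs,
      by rw [tsupport, hs]; exact hgt⟩
    rw [← h η, ← setIntegral_eq_integral_of_forall_compl_eq_zero (s := Ioi (0 : ℝ))]
    · exact integral_congr_ae (.of_forall fun x => by
        simp only [Complex.real_smul, mul_comm (v x)]; rfl)
    · intro x hx
      rw [image_eq_zero_of_notMem_tsupport fun hh => hx (hgt hh), zero_smul])
  exact (ae_restrict_iff' measurableSet_Ioi).2 this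

theorem exists_test_integral_eq_one : ∃ η : Test, ∫ x in Ioi (0 : ℝ), η x = 1 := by
  let φ : ContDiffBump (2 : ℝ) := ⟨1 / 2, 1, by norm_num, by norm_num⟩
  have hsub : tsupport (φ.normed volume) ⊆ Ioi (0 : ℝ) := by
    rw [φ.tsupport_normed_eq]
    intro x hx
    have := (Real.dist_eq x 2 ▸ Metric.mem_closedBall.1 hx : |x - 2| ≤ 1)
    have := (abs_le.1 this).1
    show 0 < x
    linarith
  have hs : Function.support (fun x => (φ.normed volume x : ℂ)) =
      Function.support (φ.normed volume) := by
    ext x; simp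
  refine ⟨⟨fun x => (φ.normed volume x : ℂ), Complex.ofRealCLM.contDiff.comp φ.contDiff_normed,
    by rw [HasCompactSupport, tsupport, hs]; exact φ.hasCompactSupport_normed,
    by rw [tsupport, hs]; exact hsub⟩, ?_⟩
  change ∫ x in Ioi (0 : ℝ), (φ.normed volume x : ℂ) = 1
  rw [setIntegral_eq_integral_of_forall_compl_eq_zero, integral_complex_ofReal, φ.integral_normed,
    Complex.ofReal_one]
  intro x hx
  rw [image_eq_zero_of_notMem_tsupport fun hh => hx (hsub hh), Complex.ofReal_zero]

/-- A test function with vanishing integral is the derivative of a test function. -/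
theorem Test.exists_deriv_eq (ψ : Test) (h : ∫ x in Ioi (0 : ℝ), ψ x = 0) :
    ∃ η : Test, deriv η = ψ := by
  obtain ⟨a, b, ha, hab, hs⟩ := ψ.exists_support
  have hψ (x : ℝ) (hx : x ∉ Ioo a b) : ψ x = 0 := image_eq_zero_of_notMem_tsupport (hs x hx)
  let F : ℝ → ℂ := fun x => ∫ t in a..x, ψ t
  have hF (x : ℝ) : HasDerivAt F (ψ x) x := by
    exact intervalIntegral.integral_hasDerivAt_right (ψ.continuous.intervalIntegrable _ _)
      (ψ.continuous.stronglyMeasurableAtFilter _ _) ψ.continuous.continuousAt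
  have hd : deriv F = ψ := funext fun x => (hF x).deriv
  have hFs (x : ℝ) (hx : x ∉ Icc a b) : F x = 0 := by
    rcases lt_or_ge x a with hxa | hxa
    · simp only [F]
      rw [intervalIntegral.integral_symm, intervalIntegral.integral_of_le hxa.le,
        setIntegral_eq_zero_of_forall_eq_zero, neg_zero]
      exact fun t ht => hψ t fun hh => absurd ht.2 (not_le.2 hh.1)
    · have hxb : b < x := not_le.1 fun hh => hx ⟨hxa, hh⟩
      rw [← h]
      simp only [F]
      rw [intervalIntegral.integral_of_le hxa]
      refine (setIntegral_eq_of_subset_of_forall_sdiff_eq_zero measurableSet_Ioi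
        (fun t ht => ha.trans ht.1) fun t ht => hψ t fun hh => ?_).symm
      exact ht.2 ⟨hh.1, hh.2.le.trans hxb.le⟩
  have hts : tsupport F ⊆ Icc a b :=
    closure_minimal (fun x hx => by_contra fun hh => hx (hFs x hh)) isClosed_Icc
  refine ⟨⟨F, ?_, ?_, hts.trans fun x hx => ha.trans_le hx.1⟩, hd⟩
  · exact contDiff_infty_iff_deriv.2 ⟨fun x => (hF x).differentiableAt, hd ▸ ψ.contDiff⟩
  · exact isCompact_Icc.of_isClosed_subset (isClosed_tsupport _) hts

/-- Integration against a test function, after subtraction of a multiple of a normalised test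
function, is integration against a derivative. -/
theorem Test.exists_deriv_eq_sub {η₀ : Test} (h₀ : ∫ x in Ioi (0 : ℝ), η₀ x = 1) (ψ : Test) :
    ∃ η : Test, ∀ x, deriv η x = ψ x - (∫ t in Ioi (0 : ℝ), ψ t) * η₀ x := by
  obtain ⟨η, hη⟩ := (ψ - (∫ t in Ioi (0 : ℝ), ψ t) • η₀).exists_deriv_eq (by
    have hi (θ : Test) : IntegrableOn θ (Ioi (0 : ℝ)) :=
      (θ.continuous.integrable_of_hasCompactSupport θ.hasCompactSupport).integrableOn
    change ∫ x in Ioi (0 : ℝ), (ψ x - (∫ t in Ioi (0 : ℝ), ψ t) * η₀ x) = 0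
    rw [integral_sub (hi ψ) ((hi η₀).const_mul _), integral_const_mul, h₀, mul_one, sub_self])
  exact ⟨η, fun x => by rw [hη]; rfl⟩

/-- Since ψ - (∫ψ) η₀ is a derivative of a test function, the hypothesis gives ∫ v ψ = (∫ψ)(∫ v η₀)
for all ψ; the constant is therefore ∫ v η₀. -/
theorem exists_ae_eq_const {v : ℝ → ℂ} (hv : LocallyIntegrableOn v (Ioi (0 : ℝ)))
    (h : ∀ η : Test, ∫ x in Ioi (0 : ℝ), v x * deriv η x = 0) :
    ∃ c : ℂ, v =ᵐ[volume.restrict (Ioi (0 : ℝ))] fun _ => c := by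
  obtain ⟨η₀, h₀⟩ := exists_test_integral_eq_one
  set c := ∫ x in Ioi (0 : ℝ), v x * η₀ x with hc
  have hcl : LocallyIntegrableOn (fun _ => c) (Ioi (0 : ℝ)) :=
    continuousOn_const.locallyIntegrableOn measurableSet_Ioi
  have := ae_eq_zero_of_forall_integral_mul_test (hv.sub hcl) fun ψ => by
    obtain ⟨η, hη⟩ := Test.exists_deriv_eq_sub h₀ ψ
    have h1 := h η
    have e1 : (fun x => v x * deriv η x) =
        fun x => v x * ψ x - (∫ t in Ioi (0 : ℝ), ψ t) * (v x * η₀ x) := by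
      funext x; rw [hη]; ring
    rw [e1, integral_sub (ψ.integrableOn_mul hv) ((η₀.integrableOn_mul hv).const_mul _),
      integral_const_mul, ← hc] at h1
    have e2 : (fun x => (v - (fun _ => c : ℝ → ℂ)) x * ψ x) = fun x => v x * ψ x - c * ψ x := by
      funext x; rw [Pi.sub_apply, sub_mul]
    rw [e2, integral_sub (ψ.integrableOn_mul hv) (ψ.integrableOn_mul hcl), integral_const_mul]
    linear_combination h1
  refine ⟨c, ?_⟩
  filter_upwards [this] with x hx
  exact sub_eq_zero.1 hx

/-- A function with a locally integrable weak derivative is locally absolutely continuous. -/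
theorem exists_isPrimitive_of_weakDeriv {u p : ℝ → ℂ}
    (hu : LocallyIntegrableOn u (Ioi (0 : ℝ))) (hp : LocallyIntegrableOn p (Ioi (0 : ℝ)))
    (h : ∀ η : Test, ∫ x in Ioi (0 : ℝ), u x * deriv η x = -∫ x in Ioi (0 : ℝ), p x * η x) :
    ∃ U, IsPrimitive U p ∧ u =ᵐ[volume.restrict (Ioi (0 : ℝ))] U := by
  have hP := isPrimitive_integral hp 0
  have hPl := hP.continuousOn.locallyIntegrableOn (μ := volume) measurableSet_Ioi
  obtain ⟨c, hc⟩ := exists_ae_eq_const (hu.sub hPl) fun η => by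
    simp only [Pi.sub_apply, sub_mul]
    rw [integral_sub (η.integrableOn_mul_deriv hu) (η.integrableOn_mul_deriv hPl),
      hP.integral_mul_deriv η, h η, sub_self]
  refine ⟨_, hP.add_const c, ?_⟩
  filter_upwards [hc] with x hx
  rw [← hx, Pi.sub_apply]
  ring

/-- A function with a locally integrable second weak derivative is continuously differentiable with
locally absolutely continuous derivative. -/
theorem exists_isPrimitive_of_weakDeriv2 {u f : ℝ → ℂ}
    (hu : LocallyIntegrableOn u (Ioi (0 : ℝ))) (hf : LocallyIntegrableOn f (Ioi (0 : ℝ)))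
    (h : ∀ η : Test, ∫ x in Ioi (0 : ℝ), u x * deriv (deriv η) x = ∫ x in Ioi (0 : ℝ), f x * η x) :
    ∃ U p, IsPrimitive U p ∧ IsPrimitive p f ∧ u =ᵐ[volume.restrict (Ioi (0 : ℝ))] U := by
  obtain ⟨η₀, h₀⟩ := exists_test_integral_eq_one
  have hP := isPrimitive_integral hf 0
  set P : ℝ → ℂ := fun x => (∫ t in (1 : ℝ)..x, f t) + 0
  have hPl := hP.continuousOn.locallyIntegrableOn (μ := volume) measurableSet_Ioi
  -- The weak derivative of `u` must be `P + c`; testing this against `η₀`, whose integral is 1,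
  -- forces this value of `c`.
  set c : ℂ := -((∫ x in Ioi (0 : ℝ), u x * deriv η₀ x) + ∫ x in Ioi (0 : ℝ), P x * η₀ x) with hc
  have hcl : LocallyIntegrableOn (fun _ => c) (Ioi (0 : ℝ)) :=
    continuousOn_const.locallyIntegrableOn measurableSet_Ioi
  obtain ⟨U, hU, hUu⟩ := exists_isPrimitive_of_weakDeriv hu (hPl.add hcl) fun ψ => by
    obtain ⟨η, hη⟩ := Test.exists_deriv_eq_sub h₀ ψ
    have h1 := h η
    have hη2 (x : ℝ) : deriv (deriv η) x =
        deriv ψ x - (∫ t in Ioi (0 : ℝ), ψ t) * deriv η₀ x := by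
      have : deriv η = fun x => ψ x - (∫ t in Ioi (0 : ℝ), ψ t) * η₀ x := funext hη
      rw [this]
      exact ((ψ.hasDerivAt x).sub ((η₀.hasDerivAt x).const_mul _)).deriv
    have e1 : (fun x => u x * deriv (deriv η) x) =
        fun x => u x * deriv ψ x - (∫ t in Ioi (0 : ℝ), ψ t) * (u x * deriv η₀ x) := by
      funext x; rw [hη2]; ring
    have h2 := hP.integral_mul_deriv η
    have e2 : (fun x => P x * deriv η x) =
        fun x => P x * ψ x - (∫ t in Ioi (0 : ℝ), ψ t) * (P x * η₀ x) := by
      funext x; rw [hη]; ring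
    rw [e1, integral_sub (ψ.integrableOn_mul_deriv hu)
      ((η₀.integrableOn_mul_deriv hu).const_mul _), integral_const_mul] at h1
    rw [e2, integral_sub (ψ.integrableOn_mul hPl) ((η₀.integrableOn_mul hPl).const_mul _),
      integral_const_mul] at h2
    have e3 : (fun x => (P + (fun _ => c : ℝ → ℂ)) x * ψ x) = fun x => P x * ψ x + c * ψ x := by
      funext x; rw [Pi.add_apply, add_mul]
    rw [e3, integral_add (ψ.integrableOn_mul hPl) (ψ.integrableOn_mul hcl), integral_const_mul, hc]
    linear_combination h1 + h2
  exact ⟨U, _, hU, hP.add_const c, hUu⟩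

/-! ### Cutoff functions -/

/-- A smooth function that equals `1` on `[2 / (n + 1), n + 1]` and vanishes outside
`[1 / (n + 1), 2 * (n + 1)]`. -/
def cutoff (n : ℕ) (x : ℝ) : ℝ :=
  Real.smoothTransition ((n + 1) * x - 1) * Real.smoothTransition (2 - x / (n + 1))

theorem cutoff_nonneg (n : ℕ) (x : ℝ) : 0 ≤ cutoff n x :=
  mul_nonneg (Real.smoothTransition.nonneg _) (Real.smoothTransition.nonneg _)

theorem cutoff_le_one (n : ℕ) (x : ℝ) : cutoff n x ≤ 1 :=
  mul_le_one₀ (Real.smoothTransition.le_one _) (Real.smoothTransition.nonneg _)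
    (Real.smoothTransition.le_one _)

theorem contDiff_cutoff (n : ℕ) : ContDiff ℝ ∞ (cutoff n) := by
  have h : ContDiff ℝ ∞ Real.smoothTransition := Real.smoothTransition.contDiff
  unfold cutoff
  exact (h.comp (by fun_prop)).mul (h.comp (by fun_prop))

theorem hasDerivAt_cutoff (n : ℕ) (x : ℝ) : HasDerivAt (cutoff n) (deriv (cutoff n) x) x :=
  ((contDiff_cutoff n).differentiable (by simp) x).hasDerivAt

theorem continuous_deriv_cutoff (n : ℕ) : Continuous (deriv (cutoff n)) :=
  (contDiff_cutoff n).continuous_deriv (by simp)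

theorem cutoff_eq_zero (n : ℕ) {x : ℝ} (hx : x ∉ Ioo (1 / (n + 1 : ℝ)) (2 * (n + 1))) :
    cutoff n x = 0 := by
  have hn : (0 : ℝ) < n + 1 := by positivity
  rcases le_or_gt x (1 / (n + 1 : ℝ)) with h | h
  · rw [cutoff, Real.smoothTransition.zero_of_nonpos, zero_mul]
    rw [le_div_iff₀ hn] at h
    linarith
  · have h2 : 2 * (n + 1 : ℝ) ≤ x := not_lt.1 fun hh => hx ⟨h, hh⟩
    rw [cutoff, Real.smoothTransition.zero_of_nonpos (x := 2 - x / (n + 1)), mul_zero]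
    rw [← le_div_iff₀ hn] at h2
    linarith

/-- A zero of a nonnegative function is a minimum, so the derivative vanishes there, including at
the endpoints of the interval. The value 1 is handled in the same way, as a maximum. -/
theorem deriv_cutoff_eq_zero (n : ℕ) {x : ℝ} (hx : x ∉ Ioo (1 / (n + 1 : ℝ)) (2 * (n + 1))) :
    deriv (cutoff n) x = 0 := by
  refine IsLocalMin.deriv_eq_zero (.of_forall fun y => ?_)
  rw [cutoff_eq_zero n hx]
  exact cutoff_nonneg n y

theorem eventually_cutoff_eq_one {x : ℝ} (hx : 0 < x) :
    ∀ᶠ n : ℕ in atTop, cutoff n x = 1 := by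
  have ht : Tendsto (fun n : ℕ => (n : ℝ)) atTop atTop := tendsto_natCast_atTop_atTop
  filter_upwards [ht.eventually_ge_atTop (2 / x), ht.eventually_ge_atTop x] with n h1 h2
  rw [div_le_iff₀ hx] at h1
  have hn : (0 : ℝ) < n + 1 := by positivity
  have h3 : x / (n + 1) ≤ 1 := (div_le_one hn).2 (by linarith)
  rw [cutoff, Real.smoothTransition.one_of_one_le (by nlinarith),
    Real.smoothTransition.one_of_one_le (by linarith), mul_one]

theorem eventually_deriv_cutoff_eq_zero {x : ℝ} (hx : 0 < x) :
    ∀ᶠ n : ℕ in atTop, deriv (cutoff n) x = 0 := by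
  filter_upwards [eventually_cutoff_eq_one hx] with n hn
  refine IsLocalMax.deriv_eq_zero (.of_forall fun y => ?_)
  rw [hn]
  exact cutoff_le_one n y

theorem deriv_smoothTransition_eq_zero {x : ℝ} (hx : x ∉ Ioo (0 : ℝ) 1) :
    deriv Real.smoothTransition x = 0 := by
  rcases le_or_gt x 0 with h | h
  · refine IsLocalMin.deriv_eq_zero (.of_forall fun y => ?_)
    rw [Real.smoothTransition.zero_of_nonpos h]
    exact Real.smoothTransition.nonneg y
  · refine IsLocalMax.deriv_eq_zero (.of_forall fun y => ?_)
    rw [Real.smoothTransition.one_of_one_le (not_lt.1 fun hh => hx ⟨h, hh⟩)]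
    exact Real.smoothTransition.le_one y

theorem exists_abs_deriv_smoothTransition_le :
    ∃ K : ℝ, 0 ≤ K ∧ ∀ x, |deriv Real.smoothTransition x| ≤ K := by
  have hc : Continuous (deriv Real.smoothTransition) :=
    (Real.smoothTransition.contDiff (n := 1)).continuous_deriv (by simp)
  obtain ⟨K, hK⟩ := (isCompact_Icc (a := (0 : ℝ)) (b := 1)).exists_bound_of_continuousOn
    hc.continuousOn
  refine ⟨K, (norm_nonneg _).trans (hK 0 (by simp)), fun x => ?_⟩
  by_cases hx : x ∈ Icc (0 : ℝ) 1
  · exact hK x hx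
  · rw [deriv_smoothTransition_eq_zero fun hh => hx (Ioo_subset_Icc_self hh), abs_zero]
    exact (norm_nonneg _).trans (hK 0 (by simp))

/-- The derivatives of the cutoff functions are bounded by a multiple of `1 / x`, uniformly. -/
theorem exists_abs_deriv_cutoff_le :
    ∃ C : ℝ, 0 ≤ C ∧ ∀ (n : ℕ) (x : ℝ), 0 < x → |deriv (cutoff n) x| ≤ C / x := by
  obtain ⟨K, hK0, hK⟩ := exists_abs_deriv_smoothTransition_le
  -- Each factor of the cutoff contributes `2 * K`: its derivative can be nonzero only where `(n +
  -- 1) * x`, respectively `x / (n + 1)`, is less than 2.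
  refine ⟨4 * K, by positivity, fun n x hx => ?_⟩
  have hn : (0 : ℝ) < n + 1 := by positivity
  have hd (y : ℝ) : HasDerivAt Real.smoothTransition (deriv Real.smoothTransition y) y :=
    ((Real.smoothTransition.contDiff (n := 1)).differentiable (by simp) y).hasDerivAt
  have h1 : HasDerivAt (fun y : ℝ => (n + 1) * y - 1) (n + 1 : ℝ) x := by
    simpa using ((hasDerivAt_id x).const_mul (n + 1 : ℝ)).sub_const 1
  have h2 : HasDerivAt (fun y : ℝ => 2 - y / (n + 1)) (-(1 / (n + 1 : ℝ))) x := by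
    simpa using ((hasDerivAt_id x).div_const (n + 1 : ℝ)).const_sub 2
  have e := (((hd _).comp x h1).mul ((hd _).comp x h2)).deriv
  change deriv (cutoff n) x = _ at e
  simp only [Function.comp_apply] at e
  set A := deriv Real.smoothTransition ((n + 1) * x - 1)
  set B := deriv Real.smoothTransition (2 - x / (n + 1))
  have hA : |A * (n + 1)| * x ≤ 2 * K := by
    rcases le_or_gt ((n + 1) * x) 2 with h | h
    · rw [abs_mul, abs_of_pos hn]
      nlinarith [hK ((n + 1) * x - 1), abs_nonneg A]
    · have : A = 0 := deriv_smoothTransition_eq_zero fun hh => by linarith [hh.2]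
      rw [this, zero_mul, abs_zero, zero_mul]
      positivity
  have hB : |B * (-(1 / (n + 1 : ℝ)))| * x ≤ 2 * K := by
    rcases le_or_gt (x / (n + 1)) 2 with h | h
    · rw [abs_mul, abs_neg, abs_of_pos (by positivity : 0 < 1 / (n + 1 : ℝ))]
      have : |B| * (1 / (n + 1)) * x = |B| * (x / (n + 1)) := by ring
      rw [this]
      have h0 : 0 ≤ x / (n + 1) := by positivity
      nlinarith [hK (2 - x / (n + 1)), abs_nonneg B]
    · have : B = 0 := deriv_smoothTransition_eq_zero fun hh => by linarith [hh.1]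
      rw [this, zero_mul, abs_zero, zero_mul]
      positivity
  rw [e, le_div_iff₀ hx]
  calc _ ≤ (|A * (n + 1)| * 1 + 1 * |B * (-(1 / (n + 1 : ℝ)))|) * x := by
        refine mul_le_mul_of_nonneg_right ((abs_add_le _ _).trans (add_le_add ?_ ?_)) hx.le
        · rw [abs_mul]
          refine mul_le_mul_of_nonneg_left ?_ (abs_nonneg _)
          rw [abs_of_nonneg (Real.smoothTransition.nonneg _)]
          exact Real.smoothTransition.le_one _
        · rw [abs_mul]
          refine mul_le_mul_of_nonneg_right ?_ (abs_nonneg _)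
          rw [abs_of_nonneg (Real.smoothTransition.nonneg _)]
          exact Real.smoothTransition.le_one _
    _ ≤ 4 * K := by linarith

/-! ### Bounds on the potential -/

/-- Completing the square in 1/x⁶: the difference of the two sides is (α/x⁶ - β)²/(2α). Half of the
repulsive term is kept, and the shift β²/(2α) makes the rest nonnegative. -/
theorem le_potential_add {α : ℝ} (hα : 0 < α) (β : ℝ) {x : ℝ} (hx : 0 < x) :
    α / (2 * x ^ 12) ≤ potential α β x + β ^ 2 / (2 * α) := by
  have h : potential α β x + β ^ 2 / (2 * α) - α / (2 * x ^ 12) =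
      (α / x ^ 6 - β) ^ 2 / (2 * α) := by
    rw [potential, abs_of_pos hx]
    field_simp
    ring
  have : 0 ≤ (α / x ^ 6 - β) ^ 2 / (2 * α) := by positivity
  linarith

theorem potential_add_nonneg {α : ℝ} (hα : 0 < α) (β : ℝ) {x : ℝ} (hx : 0 < x) :
    0 ≤ potential α β x + β ^ 2 / (2 * α) :=
  (by positivity : (0 : ℝ) ≤ α / (2 * x ^ 12)).trans (le_potential_add hα β hx)

/-- The damping factor loses only x² near 0: for x < 1 it is at least x/2, and 8/α · α/(2x¹²) ·
(x/2)² = 1/x¹⁰ ≥ 1/x². For x ≥ 1 the summand 1 suffices. This turns the damped energy bound into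
square integrability of u/x. -/
theorem one_div_sq_le {α : ℝ} (hα : 0 < α) (β : ℝ) {x : ℝ} (hx : 0 < x) :
    1 / x ^ 2 ≤ 1 + 8 / α * ((potential α β x + β ^ 2 / (2 * α)) * (x / (1 + x)) ^ 2) := by
  rcases le_or_gt 1 x with h | h
  · have h1 : 1 / x ^ 2 ≤ 1 := (div_le_one (by positivity)).2 (one_le_pow₀ h)
    have := potential_add_nonneg hα β hx
    have : 0 ≤ 8 / α * ((potential α β x + β ^ 2 / (2 * α)) * (x / (1 + x)) ^ 2) := by positivity
    linarith
  · have h2 : (x / 2) ^ 2 ≤ (x / (1 + x)) ^ 2 := by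
      gcongr
      linarith
    have h3 : 8 / α * (α / (2 * x ^ 12) * (x / 2) ^ 2) ≤
        8 / α * ((potential α β x + β ^ 2 / (2 * α)) * (x / (1 + x)) ^ 2) := by
      gcongr
      · exact potential_add_nonneg hα β hx
      · exact le_potential_add hα β hx
    have h4 : 8 / α * (α / (2 * x ^ 12) * (x / 2) ^ 2) = 1 / x ^ 10 := by
      field_simp
      norm_num
    have h5 : 1 / x ^ 2 ≤ 1 / x ^ 10 :=
      one_div_le_one_div_of_le (by positivity) (pow_le_pow_of_le_one hx.le h.le (by norm_num))
    linarith

theorem one_div_sq_le' {α : ℝ} (hα : 0 < α) (β : ℝ) {x : ℝ} (hx : 0 < x) :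
    1 / x ^ 2 ≤ 1 + 8 / α * (potential α β x + β ^ 2 / (2 * α)) := by
  refine (one_div_sq_le hα β hx).trans ?_
  have := potential_add_nonneg hα β hx
  have h1 : (x / (1 + x)) ^ 2 ≤ 1 :=
    pow_le_one₀ (by positivity) ((div_le_one (by positivity)).2 (by linarith))
  gcongr
  exact mul_le_of_le_one_right this h1

/-! ### The energy estimate -/

/-- Fatou's lemma as a criterion for integrability. -/
theorem integrable_of_tendsto_of_integral_le {X : Type*} [MeasurableSpace X] {μ : Measure X}
    {f : ℕ → X → ℝ} {g : X → ℝ} {K : ℝ} (hf : ∀ n, Integrable (f n) μ)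
    (h0 : ∀ n, 0 ≤ᵐ[μ] f n) (hK : ∀ n, ∫ x, f n x ∂μ ≤ K)
    (hg : ∀ᵐ x ∂μ, Tendsto (fun n => f n x) atTop (𝓝 (g x))) : Integrable g μ := by
  refine ⟨aestronglyMeasurable_of_tendsto_ae atTop (fun n => (hf n).1) hg, ?_⟩
  calc ∫⁻ x, ‖g x‖ₑ ∂μ ≤ ∫⁻ x, liminf (fun n => ‖f n x‖ₑ) atTop ∂μ := by
        refine lintegral_mono_ae ?_
        filter_upwards [hg] with x hx
        exact ((continuous_enorm.tendsto _).comp hx).liminf_eq.ge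
    _ ≤ liminf (fun n => ∫⁻ x, ‖f n x‖ₑ ∂μ) atTop :=
        lintegral_liminf_le' fun n => (hf n).1.enorm
    _ ≤ ENNReal.ofReal K := by
        refine liminf_le_of_le (by isBoundedDefault) fun b hb => ?_
        obtain ⟨n, hn⟩ := hb.exists
        refine hn.trans ?_
        rw [← ofReal_integral_norm_eq_lintegral_enorm (hf n)]
        refine ENNReal.ofReal_le_ofReal ((integral_congr_ae ?_).trans_le (hK n))
        filter_upwards [h0 n] with x hx
        exact Real.norm_of_nonneg hx
    _ < ⊤ := ENNReal.ofReal_lt_top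

theorem norm_sq_add_mul (a b : ℝ) (z w : ℂ) :
    ‖(a : ℂ) * z + (b : ℂ) * w‖ ^ 2 =
      a ^ 2 * ‖z‖ ^ 2 + 2 * (a * b) * (conj z * w).re + b ^ 2 * ‖w‖ ^ 2 := by
  simp only [← Complex.normSq_eq_norm_sq, Complex.normSq_apply, Complex.add_re, Complex.add_im,
    Complex.mul_re, Complex.mul_im, Complex.ofReal_re, Complex.ofReal_im, Complex.conj_re,
    Complex.conj_im]
  ring

section Energy

variable {α β : ℝ} {U p w : ℝ → ℂ}

theorem isPrimitive_ofReal {φ φ' : ℝ → ℝ} (h : ∀ x, 0 < x → HasDerivAt φ (φ' x) x)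
    (hc : ContinuousOn φ' (Ioi (0 : ℝ))) :
    IsPrimitive (fun x => (φ x : ℂ)) (fun x => (φ' x : ℂ)) :=
  .of_hasDerivAt (fun x hx => (h x hx).ofReal_comp)
    (Complex.continuous_ofReal.comp_continuousOn hc)

/-- The energy estimate: if `-u'' + V u = w` with `u, w ∈ L²`, then `(ψ u)'` is square integrable and
`(V + β² / (2 α)) |ψ u|²` is integrable, provided that `ψ' u` and `ψ u / x` are square
integrable. -/
theorem integrable_energy (hα : 0 < α) (hU : IsPrimitive U p)
    (hp : IsPrimitive p (fun x => (potential α β x : ℂ) * U x - w x))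
    (hU2 : MemLp U 2 (volume.restrict (Ioi (0 : ℝ))))
    (hw2 : MemLp w 2 (volume.restrict (Ioi (0 : ℝ))))
    {ψ ψ' : ℝ → ℝ} (hψ : ∀ x, 0 < x → HasDerivAt ψ (ψ' x) x)
    (hψ' : ContinuousOn ψ' (Ioi (0 : ℝ))) (hψ1 : ∀ x, 0 < x → |ψ x| ≤ 1)
    (h1 : Integrable (fun x => ψ' x ^ 2 * ‖U x‖ ^ 2) (volume.restrict (Ioi (0 : ℝ))))
    (h2 : Integrable (fun x => ψ x ^ 2 * (1 / x ^ 2 * ‖U x‖ ^ 2))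
      (volume.restrict (Ioi (0 : ℝ)))) :
    Integrable (fun x => ‖(ψ' x : ℂ) * U x + (ψ x : ℂ) * p x‖ ^ 2 +
      (potential α β x + β ^ 2 / (2 * α)) * (ψ x ^ 2 * ‖U x‖ ^ 2))
      (volume.restrict (Ioi (0 : ℝ))) := by
  obtain ⟨C, hC0, hC⟩ := exists_abs_deriv_cutoff_le
  set c₀ := β ^ 2 / (2 * α) with hc₀
  have hc₀0 : 0 ≤ c₀ := by positivity
  have hUw : Integrable (fun x => ‖U x‖ * ‖w x‖) (volume.restrict (Ioi (0 : ℝ))) :=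
    hU2.norm.integrable_mul hw2.norm
  have hUU : Integrable (fun x => ‖U x‖ ^ 2) (volume.restrict (Ioi (0 : ℝ))) :=
    hU2.integrable_norm_pow (p := 2) (by norm_num)
  -- An integrable majorant, independent of `n`, of everything on the right-hand side of the energy
  -- identity.
  let g : ℝ → ℝ := fun x => 2 * (ψ' x ^ 2 * ‖U x‖ ^ 2) +
    2 * C ^ 2 * (ψ x ^ 2 * (1 / x ^ 2 * ‖U x‖ ^ 2)) + ‖U x‖ * ‖w x‖ + c₀ * ‖U x‖ ^ 2
  have hg : Integrable g (volume.restrict (Ioi (0 : ℝ))) :=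
    (((h1.const_mul 2).add (h2.const_mul (2 * C ^ 2))).add hUw).add (hUU.const_mul c₀)
  let φ : ℕ → ℝ → ℝ := fun n x => ψ x * cutoff n x
  let φ' : ℕ → ℝ → ℝ := fun n x => ψ' x * cutoff n x + ψ x * deriv (cutoff n) x
  have hψc : ContinuousOn ψ (Ioi (0 : ℝ)) := fun x hx => (hψ x hx).continuousAt.continuousWithinAt
  have hφ (n : ℕ) (x : ℝ) (hx : 0 < x) : HasDerivAt (φ n) (φ' n x) x :=
    (hψ x hx).mul (hasDerivAt_cutoff n x)
  have hφc (n : ℕ) : ContinuousOn (φ n) (Ioi (0 : ℝ)) :=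
    hψc.mul (contDiff_cutoff n).continuous.continuousOn
  have hφ' (n : ℕ) : ContinuousOn (φ' n) (Ioi (0 : ℝ)) :=
    (hψ'.mul (contDiff_cutoff n).continuous.continuousOn).add
      (hψc.mul (continuous_deriv_cutoff n).continuousOn)
  have hφ1 (n : ℕ) (x : ℝ) (hx : 0 < x) : φ n x ^ 2 ≤ 1 := by
    rw [sq_le_one_iff_abs_le_one]
    simp only [φ]
    rw [abs_mul, abs_of_nonneg (cutoff_nonneg n x)]
    exact mul_le_one₀ (hψ1 x hx) (cutoff_nonneg n x) (cutoff_le_one n x)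
  have hφ'le (n : ℕ) (x : ℝ) (hx : 0 < x) :
      φ' n x ^ 2 ≤ 2 * ψ' x ^ 2 + 2 * C ^ 2 * (ψ x ^ 2 * (1 / x ^ 2)) := by
    have e1 : (ψ' x * cutoff n x) ^ 2 ≤ ψ' x ^ 2 := by
      rw [mul_pow]
      exact mul_le_of_le_one_right (sq_nonneg _)
        (pow_le_one₀ (cutoff_nonneg n x) (cutoff_le_one n x))
    have e2 : (ψ x * deriv (cutoff n) x) ^ 2 ≤ C ^ 2 * (ψ x ^ 2 * (1 / x ^ 2)) := by
      have : deriv (cutoff n) x ^ 2 ≤ (C / x) ^ 2 := by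
        rw [← sq_abs]
        exact pow_le_pow_left₀ (abs_nonneg _) (hC n x hx) 2
      calc _ = ψ x ^ 2 * deriv (cutoff n) x ^ 2 := by ring
        _ ≤ ψ x ^ 2 * (C / x) ^ 2 := mul_le_mul_of_nonneg_left this (sq_nonneg _)
        _ = _ := by ring
    have e3 : φ' n x ^ 2 ≤ 2 * (ψ' x * cutoff n x) ^ 2 + 2 * (ψ x * deriv (cutoff n) x) ^ 2 := by
      simp only [φ']
      nlinarith [sq_nonneg (ψ' x * cutoff n x - ψ x * deriv (cutoff n) x)]
    linarith
  let E : ℕ → ℝ → ℝ := fun n x => ‖(φ' n x : ℂ) * U x + (φ n x : ℂ) * p x‖ ^ 2 +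
    (potential α β x + c₀) * (φ n x ^ 2 * ‖U x‖ ^ 2)
  have hsupp (n : ℕ) (x : ℝ) (hx : x ∉ Ioo (1 / (n + 1 : ℝ)) (2 * (n + 1))) :
      φ n x = 0 ∧ φ' n x = 0 := by
    simp only [φ, φ', cutoff_eq_zero n hx, deriv_cutoff_eq_zero n hx, mul_zero, add_zero, and_self]
  -- The derivative of φ² conj(U) p, with p' replaced by V U - w. Compact support makes its integral
  -- vanish.
  let D : ℕ → ℝ → ℂ := fun n x =>
    (((φ' n x : ℂ) * φ n x + φ n x * φ' n x) * conj (U x) + (φ n x * φ n x) * conj (p x)) * p x +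
      (φ n x * φ n x) * conj (U x) * ((potential α β x : ℂ) * U x - w x)
  have hDp (n : ℕ) : IsPrimitive (fun x => (φ n x : ℂ) * φ n x * conj (U x) * p x) (D n) :=
    (((isPrimitive_ofReal (hφ n) (hφ' n)).mul (isPrimitive_ofReal (hφ n) (hφ' n))).mul
      hU.conjugate).mul hp
  have hn0 (n : ℕ) : (0 : ℝ) < 1 / (n + 1 : ℝ) := by positivity
  have hn1 (n : ℕ) : 1 / (n + 1 : ℝ) ≤ 2 * (n + 1) := by
    rw [div_le_iff₀ (by positivity)]
    nlinarith [(Nat.cast_nonneg n : (0 : ℝ) ≤ n)]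
  have hDs (n : ℕ) (x : ℝ) (hx : x ∉ Ioo (1 / (n + 1 : ℝ)) (2 * (n + 1))) : D n x = 0 := by
    simp [D, (hsupp n x hx).1]
  have hD0 (n : ℕ) : ∫ x in Ioi (0 : ℝ), D n x = 0 :=
    (hDp n).integral_eq_zero (hn0 n) (hn1 n) (by simp only [(hsupp n (1 / (n + 1)) (by simp)).1]; simp)
      (by simp only [(hsupp n (2 * (n + 1)) (by simp)).1]; simp) fun x hx =>
        hDs n x fun hh => hx ⟨hh.1, hh.2.le⟩
  have hDi (n : ℕ) : Integrable (D n) (volume.restrict (Ioi (0 : ℝ))) := by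
    refine (((hDp n).locallyIntegrableOn.integrableOn_compact_subset
      (t := Icc (1 / (n + 1 : ℝ)) (2 * (n + 1))) (fun x hx => (hn0 n).trans_le hx.1)
      isCompact_Icc).of_forall_sdiff_eq_zero measurableSet_Ioi fun x hx =>
        hDs n x fun hh => hx.2 (Ioo_subset_Icc_self hh))
  have hEle (n : ℕ) (x : ℝ) (hx : 0 < x) : E n x ≤ (D n x).re + g x := by
    -- Expanding |(φU)'|² produces exactly the cross term 2φφ' Re(conj(U) p) of `D`, so `p` does not
    -- occur in the remainder.
    have e1 : E n x = (D n x).re + φ' n x ^ 2 * ‖U x‖ ^ 2 +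
        φ n x ^ 2 * (conj (U x) * w x).re + c₀ * (φ n x ^ 2 * ‖U x‖ ^ 2) := by
      simp only [E, D]
      rw [norm_sq_add_mul]
      simp only [← Complex.normSq_eq_norm_sq, Complex.normSq_apply, Complex.add_re,
        Complex.add_im, Complex.sub_re, Complex.sub_im,
        Complex.mul_re, Complex.mul_im, Complex.ofReal_re, Complex.ofReal_im, Complex.conj_re,
        Complex.conj_im]
      ring
    have e2 : (conj (U x) * w x).re ≤ ‖U x‖ * ‖w x‖ := by
      refine (Complex.re_le_norm _).trans ?_
      rw [norm_mul, RCLike.norm_conj]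
    have e3 : φ n x ^ 2 * (conj (U x) * w x).re ≤ ‖U x‖ * ‖w x‖ :=
      (mul_le_mul_of_nonneg_left e2 (sq_nonneg _)).trans
        (mul_le_of_le_one_left (by positivity) (hφ1 n x hx))
    have e4 : c₀ * (φ n x ^ 2 * ‖U x‖ ^ 2) ≤ c₀ * ‖U x‖ ^ 2 :=
      mul_le_mul_of_nonneg_left (mul_le_of_le_one_left (by positivity) (hφ1 n x hx)) hc₀0
    have e5 := mul_le_mul_of_nonneg_right (hφ'le n x hx) (sq_nonneg ‖U x‖)
    rw [e1]
    simp only [g]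
    linarith
  have hE0 (n : ℕ) (x : ℝ) (hx : 0 < x) : 0 ≤ E n x := by
    have := potential_add_nonneg hα β hx
    positivity
  have hpos : ∀ᵐ x ∂volume.restrict (Ioi (0 : ℝ)), 0 < x := ae_restrict_mem measurableSet_Ioi
  have hmeas {F : ℝ → ℂ} (hF : ContinuousOn F (Ioi (0 : ℝ))) :
      AEStronglyMeasurable F (volume.restrict (Ioi (0 : ℝ))) :=
    hF.aestronglyMeasurable measurableSet_Ioi
  have hEi (n : ℕ) : Integrable (E n) (volume.restrict (Ioi (0 : ℝ))) := by
    refine ((hDi n).re.add hg).mono' ?_ ?_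
    · refine AEStronglyMeasurable.add ?_ (((aestronglyMeasurable_potential α β).add
        aestronglyMeasurable_const).mul ?_)
      · refine (AEStronglyMeasurable.add (hmeas ?_) (hmeas ?_)).norm.pow 2
        · exact (Complex.continuous_ofReal.comp_continuousOn (hφ' n)).mul hU.continuousOn
        · exact (Complex.continuous_ofReal.comp_continuousOn (hφc n)).mul hp.continuousOn
      · exact (((hφc n).pow 2).mul (hU.continuousOn.norm.pow 2)).aestronglyMeasurable
          measurableSet_Ioi
    · filter_upwards [hpos] with x hx
      rw [Real.norm_of_nonneg (hE0 n x hx)]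
      exact hEle n x hx
  refine integrable_of_tendsto_of_integral_le (K := ∫ x in Ioi (0 : ℝ), g x) hEi
    (fun n => hpos.mono (hE0 n)) (fun n => ?_) ?_
  · have hre : ∫ x in Ioi (0 : ℝ), (D n x).re = 0 := by
      have := integral_re (hDi n)
      simp only [RCLike.re_eq_complex_re] at this
      rw [this, hD0 n, Complex.zero_re]
    have := integral_mono_ae (hEi n) ((hDi n).re.add hg) (hpos.mono (hEle n))
    refine this.trans_eq ?_
    have e := integral_add (hDi n).re hg
    simp only [RCLike.re_eq_complex_re] at e
    rw [hre, zero_add] at e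
    exact e
  · filter_upwards [hpos] with x hx
    refine tendsto_const_nhds.congr' ?_
    filter_upwards [eventually_cutoff_eq_one hx, eventually_deriv_cutoff_eq_zero hx] with n e1 e2
    simp only [E, φ, φ', e1, e2, mul_one, mul_zero, add_zero]

/-- Square integrable solutions of `-u'' + V u = w` have finite energy. -/
theorem integrable_norm_sq_and_potential (hα : 0 < α) (hU : IsPrimitive U p)
    (hp : IsPrimitive p (fun x => (potential α β x : ℂ) * U x - w x))
    (hU2 : MemLp U 2 (volume.restrict (Ioi (0 : ℝ))))
    (hw2 : MemLp w 2 (volume.restrict (Ioi (0 : ℝ)))) :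
    Integrable (fun x => ‖p x‖ ^ 2) (volume.restrict (Ioi (0 : ℝ))) ∧
      Integrable (fun x => potential α β x * ‖U x‖ ^ 2) (volume.restrict (Ioi (0 : ℝ))) := by
  set c₀ := β ^ 2 / (2 * α) with hc₀
  have hpos : ∀ᵐ x ∂volume.restrict (Ioi (0 : ℝ)), 0 < x := ae_restrict_mem measurableSet_Ioi
  have hUU : Integrable (fun x => ‖U x‖ ^ 2) (volume.restrict (Ioi (0 : ℝ))) :=
    hU2.integrable_norm_pow (p := 2) (by norm_num)
  have hUm : AEStronglyMeasurable (fun x => ‖U x‖ ^ 2) (volume.restrict (Ioi (0 : ℝ))) := hUU.1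
  have hpm : AEStronglyMeasurable (fun x => ‖p x‖ ^ 2) (volume.restrict (Ioi (0 : ℝ))) :=
    (hp.continuousOn.norm.pow 2).aestronglyMeasurable measurableSet_Ioi
  have hVm : AEStronglyMeasurable (fun x => potential α β x + c₀)
      (volume.restrict (Ioi (0 : ℝ))) :=
    (aestronglyMeasurable_potential α β).add aestronglyMeasurable_const
  have hψc : ContinuousOn (fun x : ℝ => x / (1 + x)) (Ioi (0 : ℝ)) :=
    continuousOn_id.div (continuousOn_const.add continuousOn_id) fun x (hx : 0 < x) => by
      positivity
  -- First pass: for ψ = x/(1+x) both ψ' and ψ/x are bounded by 1, so square integrability of `U` is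
  -- the only input.
  have step1 := integrable_energy hα hU hp hU2 hw2 (ψ := fun x => x / (1 + x))
    (ψ' := fun x => 1 / (1 + x) ^ 2)
    (fun x hx => by
      have hx1 : (1 + x) ≠ 0 := by positivity
      convert! (hasDerivAt_id x).div ((hasDerivAt_id x).const_add 1) hx1 using 1
      simp)
    (continuousOn_const.div ((continuousOn_const.add continuousOn_id).pow 2)
      fun x (hx : 0 < x) => by positivity)
    (fun x hx => by
      rw [abs_of_nonneg (by positivity)]
      exact (div_le_one (by positivity)).2 (by linarith))
    (hUU.mono' (by
      refine AEStronglyMeasurable.mul (Measurable.aestronglyMeasurable (by fun_prop)) hUm) (by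
      filter_upwards [hpos] with x hx
      rw [Real.norm_of_nonneg (by positivity)]
      refine mul_le_of_le_one_left (by positivity) (pow_le_one₀ (by positivity) ?_)
      rw [div_le_one (by positivity)]
      nlinarith))
    (hUU.mono' (by
      refine AEStronglyMeasurable.mul (Measurable.aestronglyMeasurable (by fun_prop))
        (AEStronglyMeasurable.mul (Measurable.aestronglyMeasurable (by fun_prop)) hUm)) (by
      filter_upwards [hpos] with x hx
      rw [Real.norm_of_nonneg (by positivity), ← mul_assoc]
      refine mul_le_of_le_one_left (by positivity) ?_
      have : (x / (1 + x)) ^ 2 * (1 / x ^ 2) = 1 / (1 + x) ^ 2 := by field_simp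
      rw [this, div_le_one (by positivity)]
      nlinarith))
  have hinv : Integrable (fun x => 1 / x ^ 2 * ‖U x‖ ^ 2) (volume.restrict (Ioi (0 : ℝ))) := by
    refine (hUU.add (step1.const_mul (8 / α))).mono'
      (AEStronglyMeasurable.mul (Measurable.aestronglyMeasurable (by fun_prop)) hUm) ?_
    filter_upwards [hpos] with x hx
    rw [Real.norm_of_nonneg (by positivity), Pi.add_apply]
    have e1 := mul_le_mul_of_nonneg_right (one_div_sq_le hα β hx) (sq_nonneg ‖U x‖)
    refine e1.trans ?_
    rw [add_mul, one_mul]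
    refine add_le_add le_rfl ?_
    rw [mul_assoc (8 / α), mul_assoc (_ + _)]
    refine mul_le_mul_of_nonneg_left ?_ (by positivity)
    exact le_add_of_nonneg_left (sq_nonneg _)
  -- Second pass without damping, now that U/x is known to be square integrable.
  have step2 := integrable_energy hα hU hp hU2 hw2 (ψ := fun _ => 1) (ψ' := fun _ => 0)
    (fun x _ => hasDerivAt_const x 1) continuousOn_const (by simp) (by simp)
    (by simpa using hinv)
  simp only [Complex.ofReal_zero, zero_mul, Complex.ofReal_one, one_mul, zero_add, one_pow]
    at step2
  constructor
  · refine step2.mono' hpm ?_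
    filter_upwards [hpos] with x hx
    rw [Real.norm_of_nonneg (by positivity)]
    exact le_add_of_nonneg_right (mul_nonneg (potential_add_nonneg hα β hx) (sq_nonneg _))
  · have h3 : Integrable (fun x => (potential α β x + c₀) * ‖U x‖ ^ 2)
        (volume.restrict (Ioi (0 : ℝ))) := by
      refine step2.mono' (hVm.mul hUm) ?_
      filter_upwards [hpos] with x hx
      rw [Real.norm_of_nonneg (mul_nonneg (potential_add_nonneg hα β hx) (sq_nonneg _))]
      exact le_add_of_nonneg_left (sq_nonneg _)
    refine (h3.sub (hUU.const_mul c₀)).congr (.of_forall fun x => ?_)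
    simp only [Pi.sub_apply]
    ring

/-- The singularity of V dominates 1/x², so finite potential energy plays the role of Hardy's
inequality. -/
theorem memLp_div_of_integrable_potential (hα : 0 < α)
    (hU2 : MemLp U 2 (volume.restrict (Ioi (0 : ℝ))))
    (hV : Integrable (fun x => potential α β x * ‖U x‖ ^ 2) (volume.restrict (Ioi (0 : ℝ)))) :
    MemLp (fun x => ‖U x‖ / x) 2 (volume.restrict (Ioi (0 : ℝ))) := by
  have hUU : Integrable (fun x => ‖U x‖ ^ 2) (volume.restrict (Ioi (0 : ℝ))) :=
    hU2.integrable_norm_pow (p := 2) (by norm_num)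
  have hm : AEStronglyMeasurable (fun x => ‖U x‖ / x) (volume.restrict (Ioi (0 : ℝ))) := by
    simp only [div_eq_mul_inv]
    exact hU2.1.norm.mul (Measurable.aestronglyMeasurable (by fun_prop))
  rw [memLp_two_iff_integrable_sq hm]
  refine (hUU.add ((hV.add (hUU.const_mul (β ^ 2 / (2 * α)))).const_mul (8 / α))).mono'
    (hm.pow 2) ?_
  filter_upwards [ae_restrict_mem measurableSet_Ioi] with x hx
  have hx : 0 < x := hx
  rw [Real.norm_of_nonneg (by positivity)]
  have := mul_le_mul_of_nonneg_right (one_div_sq_le' hα β hx) (sq_nonneg ‖U x‖)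
  simp only [Pi.add_apply]
  calc _ = 1 / x ^ 2 * ‖U x‖ ^ 2 := by ring
    _ ≤ _ := this
    _ = _ := by ring

/-- Green's formula for a solution `u` of `-u'' + V u = w` and a function `h` of finite energy. -/
theorem integral_green (hα : 0 < α) {h h' : ℝ → ℂ}
    (hp : IsPrimitive p (fun x => (potential α β x : ℂ) * U x - w x))
    (hh : IsPrimitive h h')
    (hp2 : MemLp p 2 (volume.restrict (Ioi (0 : ℝ))))
    (hw2 : MemLp w 2 (volume.restrict (Ioi (0 : ℝ))))
    (hh2 : MemLp h 2 (volume.restrict (Ioi (0 : ℝ))))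
    (hh'2 : MemLp h' 2 (volume.restrict (Ioi (0 : ℝ))))
    (hVUh : Integrable (fun x => (potential α β x : ℂ) * (conj (U x) * h x))
      (volume.restrict (Ioi (0 : ℝ))))
    (hVh : Integrable (fun x => potential α β x * ‖h x‖ ^ 2) (volume.restrict (Ioi (0 : ℝ)))) :
    (∫ x in Ioi (0 : ℝ), conj (p x) * h' x) +
      ∫ x in Ioi (0 : ℝ), (potential α β x : ℂ) * (conj (U x) * h x) =
        ∫ x in Ioi (0 : ℝ), conj (w x) * h x := by
  obtain ⟨C, hC0, hC⟩ := exists_abs_deriv_cutoff_le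
  have hpos : ∀ᵐ x ∂volume.restrict (Ioi (0 : ℝ)), 0 < x := ae_restrict_mem measurableSet_Ioi
  have hconj {F : ℝ → ℂ} (hF : MemLp F 2 (volume.restrict (Ioi (0 : ℝ)))) :
      MemLp (fun x => conj (F x)) 2 (volume.restrict (Ioi (0 : ℝ))) :=
    hF.star
  have i1 : Integrable (fun x => conj (p x) * h' x) (volume.restrict (Ioi (0 : ℝ))) :=
    (hconj hp2).integrable_mul hh'2
  have i3 : Integrable (fun x => conj (w x) * h x) (volume.restrict (Ioi (0 : ℝ))) :=
    (hconj hw2).integrable_mul hh2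
  have i4 : Integrable (fun x => ‖p x‖ * (‖h x‖ / x)) (volume.restrict (Ioi (0 : ℝ))) :=
    hp2.norm.integrable_mul (memLp_div_of_integrable_potential hα hh2 hVh)
  let G : ℝ → ℂ := fun x => conj (p x) * h' x +
    (potential α β x : ℂ) * (conj (U x) * h x) - conj (w x) * h x
  have hG : Integrable G (volume.restrict (Ioi (0 : ℝ))) := (i1.add hVUh).sub i3
  -- The derivative of χₙ conj(p) h, for the cutoff χₙ. It integrates to zero and converges
  -- pointwise to `G`, whose vanishing integral is Green's formula.
  let D : ℕ → ℝ → ℂ := fun n x =>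
    ((deriv (cutoff n) x : ℝ) : ℂ) * (conj (p x) * h x) + (cutoff n x : ℂ) *
      (conj ((potential α β x : ℂ) * U x - w x) * h x + conj (p x) * h' x)
  have hDG (n : ℕ) (x : ℝ) : D n x =
      ((deriv (cutoff n) x : ℝ) : ℂ) * (conj (p x) * h x) + (cutoff n x : ℂ) * G x := by
    simp only [D, G, map_sub, map_mul, Complex.conj_ofReal]
    ring
  have hDp (n : ℕ) : IsPrimitive (fun x => (cutoff n x : ℂ) * (conj (p x) * h x)) (D n) :=
    (isPrimitive_ofReal (fun x _ => hasDerivAt_cutoff n x)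
      (continuous_deriv_cutoff n).continuousOn).mul (hp.conjugate.mul hh)
  have hD0 (n : ℕ) : ∫ x in Ioi (0 : ℝ), D n x = 0 := by
    refine (hDp n).integral_eq_zero (a := 1 / (n + 1 : ℝ)) (b := 2 * (n + 1)) (by positivity) ?_
      (by rw [cutoff_eq_zero n (by simp), Complex.ofReal_zero, zero_mul])
      (by rw [cutoff_eq_zero n (by simp), Complex.ofReal_zero, zero_mul]) fun x hx => ?_
    · rw [div_le_iff₀ (by positivity)]
      nlinarith [(Nat.cast_nonneg n : (0 : ℝ) ≤ n)]
    · have hx : x ∉ Ioo (1 / (n + 1 : ℝ)) (2 * (n + 1)) := fun hh => hx ⟨hh.1, hh.2.le⟩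
      simp [D, cutoff_eq_zero n hx, deriv_cutoff_eq_zero n hx]
  -- The term with χₙ' is dominated by C |p| |h|/x, integrable because both |p| and |h|/x are square
  -- integrable.
  have hlim := tendsto_integral_of_dominated_convergence (F := D) (f := G)
    (μ := volume.restrict (Ioi (0 : ℝ))) (fun x => C * (‖p x‖ * (‖h x‖ / x)) + ‖G x‖)
    (fun n => (hDp n).locallyIntegrableOn.aestronglyMeasurable)
    ((i4.const_mul C).add hG.norm)
    (fun n => by
      filter_upwards [hpos] with x hx
      rw [hDG]
      refine (norm_add_le _ _).trans (add_le_add ?_ ?_)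
      · rw [norm_mul, norm_mul, RCLike.norm_conj, Complex.norm_real, Real.norm_eq_abs]
        refine (mul_le_mul_of_nonneg_right (hC n x hx) (by positivity)).trans_eq ?_
        ring
      · rw [norm_mul, Complex.norm_real, Real.norm_of_nonneg (cutoff_nonneg n x)]
        exact mul_le_of_le_one_left (norm_nonneg _) (cutoff_le_one n x))
    (by
      filter_upwards [hpos] with x hx
      refine tendsto_const_nhds.congr' ?_
      filter_upwards [eventually_cutoff_eq_one hx, eventually_deriv_cutoff_eq_zero hx]
        with n e1 e2
      rw [hDG, e1, e2, Complex.ofReal_zero, zero_mul, Complex.ofReal_one, one_mul, zero_add])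
  simp only [hD0] at hlim
  have h0 : ∫ x in Ioi (0 : ℝ), G x = 0 := (tendsto_nhds_unique hlim tendsto_const_nhds)
  have e := integral_sub (i1.add hVUh) i3
  have e' := integral_add i1 hVUh
  change ∫ x in Ioi (0 : ℝ), G x = _ at e
  simp only [Pi.add_apply] at e
  rw [h0, e'] at e
  exact (sub_eq_zero.1 e.symm)

end Energy

/-! ### Self-adjoint extensions of symmetric operators -/

section Abstract

variable {E : Type*} [NormedAddCommGroup E] [InnerProductSpace ℂ E] [CompleteSpace E]

/-- Up to the rotation (a, b) ↦ (b, -a), the adjoint of a graph is its orthogonal complement in the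
Hilbert space `WithLp 2 (E × E)`. The double adjoint is thus governed by the double complement,
which is the closure. -/
theorem adjoint_adjoint_le_topologicalClosure (g : Submodule ℂ (E × E)) :
    g.adjoint.adjoint ≤ g.topologicalClosure := by
  rintro ⟨z₁, z₂⟩ hz
  rw [Submodule.mem_adjoint_iff] at hz
  let g' : Submodule ℂ (WithLp 2 (E × E)) :=
    g.map (WithLp.linearEquiv 2 ℂ (E × E)).symm.toLinearMap
  have hz' : WithLp.toLp 2 (z₁, z₂) ∈ g'ᗮᗮ := by
    intro y hy
    have h1 : (y.snd, -y.fst) ∈ g.adjoint := by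
      rw [Submodule.mem_adjoint_iff]
      intro a b hab
      have := hy (WithLp.toLp 2 (a, b)) ⟨(a, b), hab, rfl⟩
      rw [WithLp.prod_inner_apply] at this
      simp only [inner_neg_right, sub_neg_eq_add]
      rw [add_comm]
      exact this
    have h2 := hz _ _ h1
    rw [WithLp.prod_inner_apply]
    simp only [inner_neg_left] at h2
    have h3 : inner ℂ y.fst z₁ + inner ℂ y.snd z₂ = 0 := by linear_combination -h2
    exact h3
  rw [Submodule.orthogonal_orthogonal_eq_closure] at hz'
  have hm : Set.MapsTo (WithLp.ofLp (p := 2) (V := E × E)) g' g := by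
    rintro _ ⟨x, hx, rfl⟩
    exact hx
  exact map_mem_closure (f := WithLp.ofLp) (WithLp.prod_continuous_ofLp 2 E E) hz' hm

theorem adjoint_le_adjoint {T S : E →ₗ.[ℂ] E} (hT : Dense (T.domain : Set E)) (h : T ≤ S) :
    S.adjoint ≤ T.adjoint := by
  have hS : Dense (S.domain : Set E) := hT.mono h.1
  refine LinearPMap.IsFormalAdjoint.le_adjoint hT fun x y => ?_
  have e : T x = S ⟨x, h.1 x.2⟩ := h.2 rfl
  rw [e]
  exact (LinearPMap.adjoint_isFormalAdjoint hS).symm ⟨x, h.1 x.2⟩ y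

variable {T S : E →ₗ.[ℂ] E} (hT : Dense (T.domain : Set E)) (hTS : T.IsFormalAdjoint T)
  (hS : S.IsFormalAdjoint S) (h : T.adjoint ≤ S)

include hT hTS h in
theorem le_of_adjoint_le : T ≤ S :=
  (LinearPMap.IsFormalAdjoint.le_adjoint hT hTS).trans h

include hT hTS hS h in
-- From T ≤ S one gets S* ≤ T* ≤ S, and symmetry of S gives S ≤ S*.
theorem isSelfAdjoint_of_adjoint_le : IsSelfAdjoint S := by
  have hle := le_of_adjoint_le hT hTS h
  rw [LinearPMap.isSelfAdjoint_def]
  exact le_antisymm ((adjoint_le_adjoint hT hle).trans h)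
    (LinearPMap.IsFormalAdjoint.le_adjoint (hT.mono hle.1) hS)

include hT hTS hS h in
theorem adjoint_eq_of_adjoint_le : T.adjoint = S := by
  refine le_antisymm h ?_
  have hsa := isSelfAdjoint_of_adjoint_le hT hTS hS h
  rw [LinearPMap.isSelfAdjoint_def] at hsa
  exact hsa.ge.trans (adjoint_le_adjoint hT (le_of_adjoint_le hT hTS h))

include hT hTS hS h in
-- B = B* ≤ T* ≤ S; taking adjoints once more reverses the inclusion, as both operators are
-- self-adjoint.
theorem eq_of_isSelfAdjoint_of_le {B : E →ₗ.[ℂ] E} (hB : IsSelfAdjoint B) (hTB : T ≤ B) :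
    B = S := by
  have hsa := isSelfAdjoint_of_adjoint_le hT hTS hS h
  have hBS : B ≤ S := by
    rw [LinearPMap.isSelfAdjoint_def] at hB
    exact hB.ge.trans ((adjoint_le_adjoint hT hTB).trans h)
  refine le_antisymm hBS ?_
  have := adjoint_le_adjoint hB.dense_domain hBS
  rw [LinearPMap.isSelfAdjoint_def] at hB hsa
  rwa [hB, hsa] at this

include hT hTS hS h in
-- S is closed and extends T, hence extends the closure. Conversely S = S* = T**, whose graph lies
-- in the closure of the graph of T.
theorem isClosable_and_closure_eq_of_adjoint_le : T.IsClosable ∧ T.closure = S := by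
  have hsa := isSelfAdjoint_of_adjoint_le hT hTS hS h
  have hle := le_of_adjoint_le hT hTS h
  have hcl : T.IsClosable := hsa.isClosed.isClosable.leIsClosable hle
  refine ⟨hcl, LinearPMap.eq_of_eq_graph (le_antisymm ?_ ?_)⟩
  · rw [← hcl.graph_closure_eq_closure_graph]
    exact Submodule.topologicalClosure_minimal _ (LinearPMap.le_graph_of_le hle) hsa.isClosed
  · rw [← hcl.graph_closure_eq_closure_graph]
    have h1 : S.graph = T.graph.adjoint := by
      rw [← LinearPMap.adjoint_graph_eq_graph_adjoint hT, adjoint_eq_of_adjoint_le hT hTS hS h]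
    have h2 : S.graph = S.graph.adjoint := by
      conv_lhs => rw [← LinearPMap.isSelfAdjoint_def.1 hsa]
      exact LinearPMap.adjoint_graph_eq_graph_adjoint hsa.dense_domain
    rw [h2, h1]
    exact adjoint_adjoint_le_topologicalClosure _

end Abstract

/-! ### Functions of finite energy -/

theorem locallyIntegrableOn_of_memLp {u : ℝ → ℂ}
    (hu : MemLp u 2 (volume.restrict (Ioi (0 : ℝ)))) : LocallyIntegrableOn u (Ioi (0 : ℝ)) := by
  rw [locallyIntegrableOn_iff isOpen_Ioi.isLocallyClosed]
  intro k hk hkc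
  have h1 : MemLp u 2 (volume.restrict k) := hu.mono_measure (Measure.restrict_mono hk le_rfl)
  have : IsFiniteMeasure (volume.restrict k) := ⟨by simpa using hkc.measure_lt_top⟩
  exact h1.integrable (by norm_num)

theorem continuousOn_potential (α β : ℝ) :
    ContinuousOn (fun x => (potential α β x : ℂ)) (Ioi (0 : ℝ)) := by
  refine Complex.continuous_ofReal.comp_continuousOn ?_
  have hne (x : ℝ) (hx : x ∈ Ioi (0 : ℝ)) : |x| ≠ 0 := abs_ne_zero.2 (ne_of_gt hx)
  exact (continuousOn_const.div (continuous_abs.continuousOn.pow 12)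
    fun x hx => pow_ne_zero _ (hne x hx)).sub
      (continuousOn_const.div (continuous_abs.continuousOn.pow 6)
        fun x hx => pow_ne_zero _ (hne x hx))

theorem formDeriv_mem_graph (α β : ℝ) (φ : formDomain α β) :
    ((φ : L2), formDeriv α β φ) ∈ weakDerivGraph := by
  rw [← weakDeriv_graph]
  exact weakDeriv.mem_graph ⟨φ, φ.2.1⟩

theorem formDeriv_eq_of_mem {α β : ℝ} {φ : formDomain α β} {v : L2}
    (h : ((φ : L2), v) ∈ weakDerivGraph) : formDeriv α β φ = v := by
  have h1 := formDeriv_mem_graph α β φ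
  rw [← weakDeriv_graph] at h h1
  exact weakDeriv.mem_graph_snd_inj h1 h rfl

theorem exists_isPrimitive_formDeriv {α β : ℝ} (φ : formDomain α β) :
    ∃ U, IsPrimitive U (formDeriv α β φ) ∧
      ((φ : L2) : ℝ → ℂ) =ᵐ[volume.restrict (Ioi (0 : ℝ))] U :=
  exists_isPrimitive_of_weakDeriv (locallyIntegrableOn_of_memLp (Lp.memLp _))
    (locallyIntegrableOn_of_memLp (Lp.memLp _)) (formDeriv_mem_graph α β φ)

theorem conj_form (α β : ℝ) (φ h : formDomain α β) : conj (form α β φ h) = form α β h φ := by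
  rw [form_eq, form_eq, map_add, inner_conj_symm, ← integral_conj]
  congr 2
  funext x
  simp only [map_mul, Complex.conj_ofReal, Complex.conj_conj]
  ring

/-- The form is Hermitian because V is real. -/
theorem formOperator_isFormalAdjoint (α β : ℝ) :
    (formOperator α β).IsFormalAdjoint (formOperator α β) := by
  intro x y
  have hx := (formOperator α β).mem_graph x
  have hy := (formOperator α β).mem_graph y
  rw [formOperator_graph] at hx hy
  obtain ⟨hx1, hx⟩ := hx
  obtain ⟨hy1, hy⟩ := hy
  have e1 := hx ⟨_, hy1⟩
  have e2 := hy ⟨_, hx1⟩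
  refine e1.symm.trans ?_
  rw [← conj_form, e2, inner_conj_symm]

/-! ### The adjoint of the minimal operator -/

/-- The complex conjugate of a test function. -/
def Test.conjugate (η : Test) : Test :=
  ⟨fun x => conj (η x), Complex.conjCLE.contDiff.comp η.contDiff,
    η.hasCompactSupport.comp_left (g := fun z : ℂ => conj z) (map_zero _),
    (closure_mono (Function.support_comp_subset (g := fun z : ℂ => conj z) (map_zero _) η)).trans
      η.tsupport_subset⟩

theorem Test.conjugate_apply (η : Test) (x : ℝ) : η.conjugate x = conj (η x) := rfl

theorem hasDerivAt_conj {f : ℝ → ℂ} {f' : ℂ} {x : ℝ} (h : HasDerivAt f f' x) :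
    HasDerivAt (fun y => conj (f y)) (conj f') x :=
  h.star

theorem Test.deriv_conjugate (η : Test) : deriv η.conjugate = fun x => conj (deriv η x) :=
  funext fun x => (hasDerivAt_conj (η.hasDerivAt x)).deriv

theorem expression_conjugate (α β : ℝ) (η : Test) (x : ℝ) :
    expression α β η.conjugate x = conj (expression α β η x) := by
  have h : deriv (fun x => conj (deriv η x)) x = conj (deriv (deriv η) x) :=
    (hasDerivAt_conj (η.derivative.hasDerivAt x)).deriv
  rw [expression, expression, Test.deriv_conjugate, h, Test.conjugate_apply, map_add, map_neg,
    map_mul, Complex.conj_ofReal]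

theorem inner_testToL2 (u : L2) (η : Test) :
    inner ℂ u (testToL2 η) = ∫ x in Ioi (0 : ℝ), conj (u x) * η x := by
  rw [L2.inner_def]
  refine integral_congr_ae ?_
  filter_upwards [coeFn_testToL2 η] with x hx
  rw [RCLike.inner_apply', hx]

theorem inner_expressionToL2 (α β : ℝ) (u : L2) (η : Test) :
    inner ℂ u (expressionToL2 α β η) = ∫ x in Ioi (0 : ℝ), conj (u x) * expression α β η x := by
  rw [L2.inner_def]
  refine integral_congr_ae ?_
  filter_upwards [(memLp_expression α β η).coeFn_toLp] with x hx
  rw [RCLike.inner_apply']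
  exact congrArg _ hx

theorem dense_domain_minimalOperator (α β : ℝ) :
    Dense ((minimalOperator α β).domain : Set L2) := by
  rw [Submodule.dense_iff_topologicalClosure_eq_top,
    Submodule.topologicalClosure_eq_top_iff, Submodule.eq_bot_iff]
  intro u hu
  refine eq_zero_of_forall_test u fun η => ?_
  have h := hu (testToL2 η.conjugate) ⟨_, rfl⟩
  rw [← inner_conj_symm, inner_testToL2, ← integral_conj] at h
  rw [← h]
  simp only [map_mul, Complex.conj_conj, Test.conjugate_apply]

theorem integral_mul_expression (α β : ℝ) {v : ℝ → ℂ}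
    (hv : LocallyIntegrableOn v (Ioi (0 : ℝ))) (η : Test) :
    ∫ x in Ioi (0 : ℝ), v x * expression α β η x =
      -(∫ x in Ioi (0 : ℝ), v x * deriv (deriv η) x) +
        ∫ x in Ioi (0 : ℝ), (potential α β x : ℂ) * v x * η x := by
  have hV : LocallyIntegrableOn (fun x => (potential α β x : ℂ) * v x) (Ioi (0 : ℝ)) :=
    hv.continuousOn_mul (continuousOn_potential α β) isOpen_Ioi.isLocallyClosed
  have e := integral_add (η.derivative.integrableOn_mul_deriv hv).neg (η.integrableOn_mul hV)
  simp only [Pi.neg_apply, integral_neg, Test.coe_derivative] at e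
  rw [← e]
  refine integral_congr_ae (.of_forall fun x => ?_)
  simp only [expression]
  ring

/-- One integration by parts on each side reduces both second-derivative integrals to the same
integral of conj(f') g'; the potential terms agree because V is real. -/
theorem minimalOperator_isFormalAdjoint (α β : ℝ) :
    (minimalOperator α β).IsFormalAdjoint (minimalOperator α β) := by
  rintro ⟨_, f, rfl⟩ ⟨_, g, rfl⟩
  rw [minimalOperator_apply, minimalOperator_apply]
  simp only
  have hl {F : ℝ → ℂ} (hF : Continuous F) : LocallyIntegrableOn F (Ioi (0 : ℝ)) :=
    hF.continuousOn.locallyIntegrableOn measurableSet_Ioi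
  have e1 : inner ℂ (testToL2 f) (expressionToL2 α β g) =
      ∫ x in Ioi (0 : ℝ), f.conjugate x * expression α β g x := by
    rw [inner_expressionToL2]
    refine integral_congr_ae ?_
    filter_upwards [coeFn_testToL2 f] with x hx
    rw [hx, Test.conjugate_apply]
  have e2 : inner ℂ (expressionToL2 α β f) (testToL2 g) =
      ∫ x in Ioi (0 : ℝ), g x * expression α β f.conjugate x := by
    rw [inner_testToL2]
    refine integral_congr_ae ?_
    filter_upwards [(memLp_expression α β f).coeFn_toLp] with x hx
    rw [expression_conjugate, mul_comm]
    exact congrArg (fun z => g x * conj z) hx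
  rw [e1, e2, integral_mul_expression α β (hl g.continuous),
    integral_mul_expression α β (hl f.conjugate.continuous)]
  have e3 := g.isPrimitive.integral_mul_deriv f.conjugate.derivative
  have e4 := f.conjugate.isPrimitive.integral_mul_deriv g.derivative
  simp only [Test.coe_derivative] at e3 e4
  rw [e3, e4]
  congr 1
  · congr 2
    exact integral_congr_ae (.of_forall fun x => mul_comm _ _)
  · exact integral_congr_ae (.of_forall fun x => by ring)

/-- Regularity of weak solutions: a square integrable weak solution of `-u'' + V u = w` with square
integrable `w` has finite energy and solves the equation in the sense of forms. -/
theorem mem_formOperatorGraph_of_forall_test {α : ℝ} (hα : 0 < α) (β : ℝ) {u w : L2}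
    (h : ∀ η : Test, inner ℂ w (testToL2 η) = inner ℂ u (expressionToL2 α β η)) :
    (u, w) ∈ formOperatorGraph α β := by
  have hu := locallyIntegrableOn_of_memLp (Lp.memLp u)
  have hw := locallyIntegrableOn_of_memLp (Lp.memLp w)
  have hV : LocallyIntegrableOn (fun x => (potential α β x : ℂ) * u x) (Ioi (0 : ℝ)) :=
    hu.continuousOn_mul (continuousOn_potential α β) isOpen_Ioi.isLocallyClosed
  obtain ⟨U, p, hU, hp, huU⟩ := exists_isPrimitive_of_weakDeriv2 hu (hV.sub hw) fun η => by
    -- Testing with the conjugate of `η` and conjugating the result removes the conjugates on `u`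
    -- and `w` caused by the inner product.
    have h1 := congrArg conj (h η.conjugate)
    rw [inner_testToL2, inner_expressionToL2, ← integral_conj, ← integral_conj] at h1
    simp only [map_mul, Complex.conj_conj, Test.conjugate_apply, expression_conjugate] at h1
    rw [integral_mul_expression α β hu] at h1
    have e := integral_sub (η.integrableOn_mul hV) (η.integrableOn_mul hw)
    simp only [Pi.sub_apply, sub_mul]
    rw [e, h1]
    ring
  have hp : IsPrimitive p (fun x => (potential α β x : ℂ) * U x - w x) := by
    refine hp.congr ?_
    filter_upwards [huU] with x hx
    rw [Pi.sub_apply, hx]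
  have hU2 : MemLp U 2 (volume.restrict (Ioi (0 : ℝ))) := (memLp_congr_ae huU).1 (Lp.memLp u)
  obtain ⟨hpi, hVi⟩ := integrable_norm_sq_and_potential hα hU hp hU2 (Lp.memLp w)
  have hp2 : MemLp p 2 (volume.restrict (Ioi (0 : ℝ))) :=
    (memLp_two_iff_integrable_sq_norm
      (hp.continuousOn.aestronglyMeasurable measurableSet_Ioi)).2 hpi
  have hgraph : (u, hp2.toLp p) ∈ weakDerivGraph := by
    intro η
    have e1 : ∫ x in Ioi (0 : ℝ), u x * deriv η x = ∫ x in Ioi (0 : ℝ), U x * deriv η x := by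
      refine integral_congr_ae ?_
      filter_upwards [huU] with x hx
      rw [hx]
    have e2 : ∫ x in Ioi (0 : ℝ), hp2.toLp p x * η x = ∫ x in Ioi (0 : ℝ), p x * η x := by
      refine integral_congr_ae ?_
      filter_upwards [hp2.coeFn_toLp] with x hx
      rw [hx]
    simp only
    rw [e1, e2, hU.integral_mul_deriv η]
  have hmem : u ∈ formDomain α β := by
    refine ⟨Submodule.mem_map.2 ⟨_, hgraph, rfl⟩, hVi.congr ?_⟩
    filter_upwards [huU] with x hx
    rw [hx]
  refine ⟨hmem, fun k => ?_⟩
  obtain ⟨K, hK, hkK⟩ := exists_isPrimitive_formDeriv k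
  have hVK : Integrable (fun x => (potential α β x : ℂ) * (conj (U x) * K x))
      (volume.restrict (Ioi (0 : ℝ))) := by
    refine (integrable_potential_mul hmem.2 k.2.2).congr ?_
    filter_upwards [huU, hkK] with x h1 h2
    rw [h1, h2]
  have hgreen := integral_green hα hp hK hp2 (Lp.memLp w)
    ((memLp_congr_ae hkK).1 (Lp.memLp _)) (Lp.memLp _) hVK (k.2.2.congr (by
      filter_upwards [hkK] with x h1
      rw [h1]))
  have hd : formDeriv α β ⟨u, hmem⟩ = hp2.toLp p := formDeriv_eq_of_mem hgraph
  rw [form, hd, L2.inner_def]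
  refine Eq.trans ?_ (hgreen.trans ?_)
  · congr 1
    · refine integral_congr_ae ?_
      filter_upwards [hp2.coeFn_toLp] with x hx
      rw [hx]
    · refine integral_congr_ae ?_
      filter_upwards [huU, hkK] with x h1 h2
      simp only [h1, h2]
  · refine integral_congr_ae ?_
    filter_upwards [hkK] with x h1
    rw [RCLike.inner_apply', h1]

theorem adjoint_minimalOperator_le {α : ℝ} (hα : 0 < α) (β : ℝ) :
    (minimalOperator α β).adjoint ≤ formOperator α β := by
  refine LinearPMap.le_of_le_graph ?_
  rintro ⟨u, w⟩ huw
  rw [formOperator_graph]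
  refine mem_formOperatorGraph_of_forall_test hα β fun η => ?_
  rw [LinearPMap.adjoint_graph_eq_graph_adjoint (dense_domain_minimalOperator α β),
    Submodule.mem_adjoint_iff] at huw
  have hη := (minimalOperator α β).mem_graph ⟨testToL2 η, η, rfl⟩
  rw [minimalOperator_apply] at hη
  have := sub_eq_zero.1 (huw _ _ hη)
  rw [← inner_conj_symm, ← inner_conj_symm u, this]

end LennardJones

end

/-! ### Self-adjointness, uniqueness of the extension and essential self-adjointness -/

theorem mainTheorem4 (α β : ℝ) (hα : 0 < α) (hβ : 0 < β) :
    IsSelfAdjoint (LennardJones.formOperator α β) ∧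
      LennardJones.minimalOperator α β ≤ LennardJones.formOperator α β ∧
      (∀ B : LennardJones.L2 →ₗ.[ℂ] LennardJones.L2, IsSelfAdjoint B →
        LennardJones.minimalOperator α β ≤ B → B = LennardJones.formOperator α β) ∧
      LennardJones.IsEssentiallySelfAdjoint (LennardJones.minimalOperator α β) := by
  have hT := LennardJones.dense_domain_minimalOperator α β
  have hTs := LennardJones.minimalOperator_isFormalAdjoint α β
  have hS := LennardJones.formOperator_isFormalAdjoint α β
  have h := LennardJones.adjoint_minimalOperator_le hα β
  have hsa := LennardJones.isSelfAdjoint_of_adjoint_le hT hTs hS h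
  obtain ⟨hc, he⟩ := LennardJones.isClosable_and_closure_eq_of_adjoint_le hT hTs hS h
  exact ⟨hsa, LennardJones.le_of_adjoint_le hT hTs h,
    fun _ hB hTB => LennardJones.eq_of_isSelfAdjoint_of_le hT hTs hS h hB hTB, hc, he ▸ hsa⟩
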